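/- Let $n\ge 0$ be an integer and let $\mathbb H^n$ be hyperbolic $n$-space. A subset of $\mathbb H^n$ is convex if it contains every geodesic segment with endpoints in it, and $hull(A)$ is the smallest convex set containing $A$. For $D\ge 0$, a set $A\subset\mathbb H^n$ is $D$-quasiconvex if every geodesic segment with endpoints in $A$ is contained in the radius-$D$ neighborhood $\mathcal N_D(A)=\{x : d(x,A)\le D\}$ (with $\mathcal N_D(\emptyset)=\emptyset$). For a discrete subgroup $\Gamma<\mathrm{Isom}(\mathbb H^n)$ and $\epsilon>0$ set $$Thin_\epsilon(\Gamma)=\{x\in\mathbb H^n \mid \exists\, \gamma\in\Gamma,\ \gamma\neq 1,\ d(x,\gamma(x))<\epsilon\},$$ and let $hull_\epsilon(\Gamma)$, the $\epsilon$-thickened convex hull of $\Gamma$, be the smallest nonempty closed $\Gamma$-invariant convex subset of $\mathbb H^n$ that contains $Thin_\epsilon(\Gamma)$, that is, the intersection of all such subsets (for trivial $\Gamma$ and $n\ge 1$ no smallest one exists, and $hull_\epsilon(\Gamma)$ is this intersection, the empty set). For $A\subset\mathbb H^n$ put $hull_\epsilon(A,\Gamma)=hull(A\cup hull_\epsilon(\Gamma))$.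 A $(\Delta,\Gamma)$-equivariant carrier graph is a continuous map $\tilde f:\tilde X\to\mathbb H^n$, where $\tilde X$ is a (nonempty) connected, locally finite graph, loops and multiple edges being allowed, and $\Delta<\mathrm{Aut}(\tilde X)$ acts freely on the geometric realization of $\tilde X$ with finite quotient graph $\tilde X/\Delta$, such that there is a surjective homomorphism $\rho:\Delta\to\Gamma$ with $\tilde f(\delta x)=\rho(\delta)\tilde f(x)$ for all $\delta\in\Delta$, $x\in\tilde X$. Proposition. For all integers $n\ge 0$, $k\ge 0$ and all $\epsilon>0$ there is a constant $D=D(n,\epsilon,k)\ge 0$ such that the following holds. Let $\Gamma<\mathrm{Isom}(\mathbb H^n)$ be discrete and let $\tilde f:\tilde X\to\mathbb H^n$ be a $(\Delta,\Gamma)$-equivariant carrier graph that maps each edge of $\tilde X$ onto a (possibly degenerate) geodesic segment, where $\tilde X/\Delta$ has exactly $k$ edges. Then $hull_\epsilon(\Gamma)\cup\tilde f(\tilde X)$ is $D$-quasiconvex, and $$hull_\epsilon(\Gamma)\cup\tilde f(\tilde X)\ \subset\ hull_\epsilon(\tilde f(\tilde X),\Gamma)\ \subset\ \mathcal N_D\big(hull_\epsilon(\Gamma)\cup\tilde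 f(\tilde X)\big).$$ -/

import Mathlib

open Set Topology

universe u

/-! ### Hyperbolic space -/

/-- Hyperbolic `n`-space `ℍⁿ` in the hyperboloid model: the points `(space, time)` of
`ℝⁿ × ℝ` with `time > 0` and `‖space‖² - time² = -1`. -/
@[ext]
structure HypSpace (n : ℕ) where
  space : EuclideanSpace ℝ (Fin n)
  time : ℝ
  time_pos : 0 < time
  time_sq : time ^ 2 = 1 + ‖space‖ ^ 2

namespace HypSpace

variable {n : ℕ}

/-- The negative of the Lorentz product; it equals `cosh` of the hyperbolic distance. -/
noncomputable def form (x y : HypSpace n) : ℝ := x.time * y.time - inner ℝ x.space y.space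

theorem form_comm (x y : HypSpace n) : form x y = form y x := by
  unfold form
  rw [real_inner_comm, mul_comm]

theorem form_self (x : HypSpace n) : form x x = 1 := by
  unfold form
  rw [real_inner_self_eq_norm_sq]
  linarith [x.time_sq, sq x.time]

theorem one_le_form (x y : HypSpace n) : 1 ≤ form x y := by
  have h1 := real_inner_le_norm x.space y.space
  have hx := x.time_sq
  have hy := y.time_sq
  have h2 : (1 + ‖x.space‖ * ‖y.space‖) ^ 2 ≤ (x.time * y.time) ^ 2 := by
    rw [mul_pow, hx, hy]
    nlinarith [sq_nonneg (‖x.space‖ - ‖y.space‖)]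
  have h3 := abs_le_of_sq_le_sq' h2 (mul_pos x.time_pos y.time_pos).le
  unfold form
  linarith [h3.2]

/-- The Lorentz form is positive definite on the orthogonal complement of a point of `ℍⁿ`. -/
theorem norm_sq_le_of_orthogonal (y : HypSpace n) (p : EuclideanSpace ℝ (Fin n)) (s : ℝ)
    (h : s * y.time = inner ℝ p y.space) : ‖p‖ ^ 2 ≤ y.time ^ 2 * (‖p‖ ^ 2 - s ^ 2) := by
  have h1 : (s * y.time) ^ 2 ≤ ‖p‖ ^ 2 * ‖y.space‖ ^ 2 := by
    rw [h, ← mul_pow]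
    exact sq_le_sq' (by linarith [neg_le_of_abs_le (abs_real_inner_le_norm p y.space)])
      (real_inner_le_norm _ _)
  have hy := y.time_sq
  have h2 : ‖y.space‖ ^ 2 = y.time ^ 2 - 1 := by linarith
  rw [h2] at h1
  nlinarith

theorem form_cauchy (x y z : HypSpace n) :
    (form x z - form x y * form y z) ^ 2 ≤ (form x y ^ 2 - 1) * (form y z ^ 2 - 1) := by
  have key : ∀ r : ℝ, 0 ≤ (form y z ^ 2 - 1) * (r * r)
      + (2 * (form x y * form y z - form x z)) * r + (form x y ^ 2 - 1) := by
    intro r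
    have hx : x.time * x.time - inner ℝ x.space x.space = 1 := form_self x
    have hy : y.time * y.time - inner ℝ y.space y.space = 1 := form_self y
    have hz : z.time * z.time - inner ℝ z.space z.space = 1 := form_self z
    have cyx := real_inner_comm y.space x.space
    have czx := real_inner_comm z.space x.space
    have czy := real_inner_comm z.space y.space
    set q : ℝ := form x y + r * form y z with hq
    have h0 := norm_sq_le_of_orthogonal y (x.space + r • z.space - q • y.space)
      (x.time + r * z.time - q * y.time) (by
        simp only [inner_sub_left, inner_add_left, real_inner_smul_left]
        rw [hq]
        unfold form
        rw [czy]
        linear_combination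
          (-(x.time * y.time - inner ℝ x.space y.space)
            - r * (y.time * z.time - inner ℝ z.space y.space)) * hy)
    have h1 : 0 ≤ ‖x.space + r • z.space - q • y.space‖ ^ 2
        - (x.time + r * z.time - q * y.time) ^ 2 :=
      nonneg_of_mul_nonneg_right ((sq_nonneg _).trans h0) (pow_pos y.time_pos 2)
    rw [← real_inner_self_eq_norm_sq] at h1
    simp only [inner_sub_left, inner_add_left, real_inner_smul_left, inner_sub_right,
      inner_add_right, real_inner_smul_right] at h1
    rw [← cyx, ← czx, ← czy] at h1
    have e : form x y = x.time * y.time - inner ℝ x.space y.space := rfl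
    have e' : form y z = y.time * z.time - inner ℝ y.space z.space := rfl
    have e'' : form x z = x.time * z.time - inner ℝ x.space z.space := rfl
    have i1 : inner ℝ x.space y.space = x.time * y.time - form x y := by linarith
    have i2 : inner ℝ y.space z.space = y.time * z.time - form y z := by linarith
    have i3 : inner ℝ x.space z.space = x.time * z.time - form x z := by linarith
    rw [i1, i2, i3] at h1
    rw [hq] at h1
    linear_combination h1 - hx - r ^ 2 * hz - (form x y + r * form y z) ^ 2 * hy
  have h := discrim_le_zero key
  unfold discrim at h
  nlinarith

noncomputable instance : Dist (HypSpace n) := ⟨fun x y => Real.arcosh (form x y)⟩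

/-- The hyperbolic distance, `cosh d(x, y) = time x * time y - ⟪space x, space y⟫`. -/
theorem dist_def (x y : HypSpace n) : dist x y = Real.arcosh (form x y) := rfl

theorem dist_triangle' (x y z : HypSpace n) : dist x z ≤ dist x y + dist y z := by
  have hxy := one_le_form x y
  have hyz := one_le_form y z
  have hxz := one_le_form x z
  have h0 : 0 ≤ dist x y + dist y z :=
    add_nonneg (Real.arcosh_nonneg hxy) (Real.arcosh_nonneg hyz)
  rw [← Real.arcosh_cosh h0]
  refine (Real.arcosh_le_arcosh (by linarith) (Real.cosh_pos _)).2 ?_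
  rw [Real.cosh_add, dist_def, dist_def, Real.cosh_arcosh hxy, Real.cosh_arcosh hyz,
    Real.sinh_arcosh hxy, Real.sinh_arcosh hyz, ← Real.sqrt_mul (by nlinarith)]
  have h := Real.le_sqrt_of_sq_le (form_cauchy x y z)
  linarith

theorem eq_of_form_eq_one (x y : HypSpace n) (h : form x y = 1) : x = y := by
  have hx : x.time * x.time - inner ℝ x.space x.space = 1 := form_self x
  have hy : y.time * y.time - inner ℝ y.space y.space = 1 := form_self y
  have cyx := real_inner_comm y.space x.space
  have hxy : x.time * y.time - inner ℝ x.space y.space = 1 := h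
  have h0 := norm_sq_le_of_orthogonal y (x.space - y.space) (x.time - y.time) (by
    rw [inner_sub_left]
    linarith)
  have h1 : ‖x.space - y.space‖ ^ 2 - (x.time - y.time) ^ 2 = 0 := by
    rw [← real_inner_self_eq_norm_sq]
    simp only [inner_sub_left, inner_sub_right]
    nlinarith
  rw [h1, mul_zero] at h0
  have h2 : ‖x.space - y.space‖ ^ 2 = 0 := le_antisymm h0 (sq_nonneg _)
  have h3 : x.time - y.time = 0 := by
    rw [h2] at h1
    exact pow_eq_zero_iff (two_ne_zero) |>.1 (by linarith)
  ext1
  · exact sub_eq_zero.1 (norm_eq_zero.1 (pow_eq_zero_iff two_ne_zero |>.1 h2))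
  · linarith

noncomputable instance : MetricSpace (HypSpace n) where
  dist_self x := by rw [dist_def, form_self]; exact Real.arcosh_zero
  dist_comm x y := by rw [dist_def, dist_def, form_comm]
  dist_triangle := dist_triangle'
  eq_of_dist_eq_zero {x y} h :=
    eq_of_form_eq_one x y ((Real.arcosh_eq_zero_iff (one_le_form x y)).1 h)

/-- The topology of `Isom(ℍⁿ)`: the compact-open topology. -/
noncomputable instance : TopologicalSpace (HypSpace n ≃ᵢ HypSpace n) :=
  TopologicalSpace.induced
    (fun g => (⟨g, g.continuous⟩ : C(HypSpace n, HypSpace n))) inferInstance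

end HypSpace

/-! ### Convexity -/

section Convexity

variable {M : Type*} [MetricSpace M]

/-- `S` is a geodesic segment from `x` to `y`: the image of an isometric embedding of a compact
interval `[0, L]`, where `L ≥ 0`. -/
def IsGeodesicSegment (x y : M) (S : Set M) : Prop :=
  ∃ (L : ℝ) (c : ℝ → M), 0 ≤ L ∧ c 0 = x ∧ c L = y ∧
    (∀ s ∈ Icc 0 L, ∀ t ∈ Icc 0 L, dist (c s) (c t) = |s - t|) ∧ c '' Icc 0 L = S

/-- Every geodesic segment with endpoints in `A` is contained in `A`. -/
def GeodesicallyConvex (A : Set M) : Prop :=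
  ∀ x ∈ A, ∀ y ∈ A, ∀ S : Set M, IsGeodesicSegment x y S → S ⊆ A

/-- The smallest convex set that contains `A`. -/
def geodesicHull (A : Set M) : Set M :=
  ⋂₀ {C : Set M | GeodesicallyConvex C ∧ A ⊆ C}

/-- Every geodesic segment with endpoints in `A` lies in the radius-`D` neighborhood of `A`. -/
def IsQuasiconvex (D : ℝ) (A : Set M) : Prop :=
  ∀ x ∈ A, ∀ y ∈ A, ∀ S : Set M, IsGeodesicSegment x y S → S ⊆ Metric.cthickening D A

end Convexity

/-! ### Thickened convex hulls -/

section ThickenedHull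

variable {n : ℕ}

/-- The points that some nontrivial element of `Γ` moves by less than `ε`. -/
def thinPart (ε : ℝ) (Γ : Subgroup (HypSpace n ≃ᵢ HypSpace n)) : Set (HypSpace n) :=
  {x | ∃ γ ∈ Γ, γ ≠ 1 ∧ dist x (γ x) < ε}

/-- The `ε`-thickened convex hull of `Γ`: the smallest nonempty `Γ`-invariant closed convex
set that contains the thin part. (For trivial `Γ` and `n ≥ 1` there is no smallest such
set, and the intersection is empty, like the limit set and the thin part.) -/
def thickenedHull (ε : ℝ) (Γ : Subgroup (HypSpace n ≃ᵢ HypSpace n)) : Set (HypSpace n) :=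
  ⋂₀ {C : Set (HypSpace n) | C.Nonempty ∧ IsClosed C ∧ GeodesicallyConvex C ∧
    (∀ γ ∈ Γ, ∀ x ∈ C, γ x ∈ C) ∧ thinPart ε Γ ⊆ C}

/-- The `ε`-thickened convex hull of a set `A` with respect to `Γ`. -/
def thickenedHullOf (ε : ℝ) (A : Set (HypSpace n))
    (Γ : Subgroup (HypSpace n ≃ᵢ HypSpace n)) : Set (HypSpace n) :=
  geodesicHull (A ∪ thickenedHull ε Γ)

end ThickenedHull

/-! ### Graphs and equivariant carrier graphs -/

/-- A graph, loops and multiple edges allowed, in Serre's formalism: `E` is the set of oriented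
edges, `rev` reverses the orientation, and `{e, rev e}` is a geometric edge. -/
structure SerreGraph where
  V : Type u
  E : Type u
  src : E → V
  rev : E → E
  rev_rev : ∀ e, rev (rev e) = e
  rev_ne : ∀ e, rev e ≠ e

namespace SerreGraph

variable (X : SerreGraph.{u})

def tgt (e : X.E) : X.V := X.src (X.rev e)

/-- The graph is nonempty and any two vertices are joined by an edge path. -/
def Connected : Prop :=
  Nonempty X.V ∧ ∀ a b : X.V, Relation.ReflTransGen (fun p q => ∃ e, X.src e = p ∧ X.tgt e = q) a b

def LocallyFinite : Prop := ∀ a : X.V, {e : X.E | X.src e = a}.Finite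

/-- The automorphism group of the graph. -/
def Aut : Subgroup (Equiv.Perm X.V × Equiv.Perm X.E) where
  carrier := {φ | (∀ e, X.src (φ.2 e) = φ.1 (X.src e)) ∧ ∀ e, X.rev (φ.2 e) = φ.2 (X.rev e)}
  mul_mem' {φ ψ} hφ hψ := by
    refine ⟨fun e => ?_, fun e => ?_⟩
    · simp [hφ.1, hψ.1]
    · simp [hφ.2, hψ.2]
  one_mem' := by simp
  inv_mem' {φ} hφ := by
    refine ⟨fun e => ?_, fun e => ?_⟩
    · have h := hφ.1 (φ.2⁻¹ e)
      simp only [Equiv.Perm.coe_inv, Equiv.apply_symm_apply] at h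
      simp [h]
    · have h := hφ.2 (φ.2⁻¹ e)
      simp only [Equiv.Perm.coe_inv, Equiv.apply_symm_apply] at h
      simp [h]

/-- The disjoint union of the discrete set of vertices and one interval per oriented edge. -/
def Cells : Type u := X.V ⊕ (Σ _ : X.E, unitInterval)

instance : TopologicalSpace X.Cells :=
  @instTopologicalSpaceSum X.V (Σ _ : X.E, unitInterval) ⊥ inferInstance

/-- The gluing of the cells: the start of the interval of `e` is the vertex `src e`, and the
intervals of `e` and `rev e` are identified by the reflection (so that the end of the interval
of `e` is the vertex `tgt e`). -/
inductive Glue : X.Cells → X.Cells → Prop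
  | start (e : X.E) : Glue (Sum.inr ⟨e, 0⟩) (Sum.inl (X.src e))
  | flip (e : X.E) (t : unitInterval) :
      Glue (Sum.inr ⟨e, t⟩) (Sum.inr ⟨X.rev e, unitInterval.symm t⟩)

/-- The geometric realization of the graph, a one-dimensional CW complex. -/
def Realization : Type u := Quot X.Glue

instance : TopologicalSpace X.Realization := inferInstanceAs (TopologicalSpace (Quot X.Glue))

/-- The closed edge of the realization that corresponds to `e`. -/
def edgeSet (e : X.E) : Set X.Realization :=
  range fun t : unitInterval => (Quot.mk X.Glue (Sum.inr ⟨e, t⟩) : X.Realization)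

/-- The action of an automorphism on the cells. -/
def actCells (φ : X.Aut) : X.Cells → X.Cells
  | Sum.inl a => Sum.inl (φ.1.1 a)
  | Sum.inr ⟨e, t⟩ => Sum.inr ⟨φ.1.2 e, t⟩

/-- The action of an automorphism on the realization. -/
def act (φ : X.Aut) : X.Realization → X.Realization :=
  Quot.map (X.actCells φ) (by
    rintro _ _ (e | ⟨e, t⟩)
    · simp only [actCells]
      rw [← φ.2.1 e]
      exact Glue.start _
    · simp only [actCells]
      rw [← φ.2.2 e]
      exact Glue.flip _ _)

/-- The vertices of the quotient graph `X / Δ`. -/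
def QuotientVertices (Δ : Subgroup X.Aut) : Type u :=
  Quot fun a b : X.V => ∃ δ ∈ Δ, b = δ.1.1 a

/-- The (geometric) edges of the quotient graph `X / Δ`. -/
def QuotientEdges (Δ : Subgroup X.Aut) : Type u :=
  Quot fun e e' : X.E => ∃ δ ∈ Δ, e' = δ.1.2 e ∨ e' = X.rev (δ.1.2 e)

end SerreGraph

/-- `f` is a `(Δ, Γ)`-equivariant carrier graph: `X` is a connected, locally finite graph,
`Δ ≤ Aut X` acts freely on (the realization of) `X` with finite quotient graph, and the continuous
map `f` is equivariant with respect to a surjective homomorphism `Δ → Γ`. -/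
structure IsEquivariantCarrierGraph {n : ℕ} (X : SerreGraph.{u}) (Δ : Subgroup X.Aut)
    (Γ : Subgroup (HypSpace n ≃ᵢ HypSpace n)) (f : C(X.Realization, HypSpace n)) : Prop where
  connected : X.Connected
  locallyFinite : X.LocallyFinite
  free : ∀ δ ∈ Δ, ∀ p : X.Realization, X.act δ p = p → δ = 1
  finite_vertices : Finite (X.QuotientVertices Δ)
  finite_edges : Finite (X.QuotientEdges Δ)
  equivariant : ∃ ρ : Δ →* Γ, Function.Surjective ρ ∧
    ∀ (δ : Δ) (p : X.Realization), f (X.act δ.1 p) = (ρ δ).1 (f p)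

/-! Let C be the thickened hull and Y the image of the graph, and suppose that Γ is nontrivial. Then
C is nonempty, every nontrivial element of Γ moves each point outside C by at least ε, and the
nearest-point projection o to C is Γ-equivariant. Triangles are uniformly thin, so a geodesic
between points x, y of C ∪ Y runs close to the union of the perpendiculars [x, o x], [y, o y] and
the segment [o x, o y], which lies in C. It therefore suffices that the perpendiculars from points
of Y stay within a uniform distance of C ∪ Y.

Suppose that some p in [x, o x] is far from C ∪ Y. For adjacent vertices v, w, the image of the edge
and the segment [o v, o w] both stay away from p, so if the perpendicular from v passes near p, then
so does the one from w, with a bounded loss (`PassesNear.step`). On the other hand, for γ ≠ 1 the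
perpendiculars from a and γ a cannot both pass near p, because displacements grow with the distance
to C (`IsNearest.form_map_sub_one_le`, `not_passesNear_map`). Hence each step of the spreading must
use up a new edge of the quotient or reach nothing new, and with k edges in the quotient all
vertices are reached within k + 1 steps, that is, with a total loss that depends only on k
(`mem_of_growth`, `passesNear_vertex`). In particular the perpendiculars from v and γ v both pass
near p, a contradiction. For trivial Γ the same spreading works with one endpoint of the given
geodesic in place of the projection.

Two further ingredients: C is nonempty, since an isometry with displacement bounded below has an
axis point common to all its invariant closed convex sets (`exists_mem_of_displacement`); and a
point far from a quasiconvex set is separated from it by a half-space, which bounds the hull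
(`geodesicHull_subset_cthickening`). -/

/-! ### The Lorentz form -/

namespace HypSpace

variable {n : ℕ}

/-- Minkowski space `ℝⁿ × ℝ`, which contains the hyperboloid. -/
abbrev Minkowski (n : ℕ) : Type := EuclideanSpace ℝ (Fin n) × ℝ

/-- The Lorentz form, with the sign for which the points of the hyperboloid have square `1`. -/
noncomputable def lorentz : Minkowski n →ₗ[ℝ] Minkowski n →ₗ[ℝ] ℝ :=
  LinearMap.mk₂ ℝ (fun v w => v.2 * w.2 - inner ℝ v.1 w.1)
    (fun v v' w => by simp only [Prod.fst_add, Prod.snd_add, inner_add_left]; ring)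
    (fun c v w => by
      simp only [Prod.smul_fst, Prod.smul_snd, real_inner_smul_left, smul_eq_mul]; ring)
    (fun v w w' => by simp only [Prod.fst_add, Prod.snd_add, inner_add_right]; ring)
    (fun c v w => by
      simp only [Prod.smul_fst, Prod.smul_snd, real_inner_smul_right, smul_eq_mul]; ring)

theorem lorentz_apply (v w : Minkowski n) : lorentz v w = v.2 * w.2 - inner ℝ v.1 w.1 := rfl

theorem lorentz_comm (v w : Minkowski n) : lorentz v w = lorentz w v := by
  rw [lorentz_apply, lorentz_apply, real_inner_comm, mul_comm]

/-- A point of hyperbolic space as a vector of Minkowski space. -/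
def vec (x : HypSpace n) : Minkowski n := (x.space, x.time)

theorem lorentz_vec (x y : HypSpace n) : lorentz x.vec y.vec = form x y := rfl

theorem vec_injective : Function.Injective (vec : HypSpace n → Minkowski n) := fun _ _ h =>
  HypSpace.ext (congrArg Prod.fst h) (congrArg Prod.snd h)

theorem form_pos (x y : HypSpace n) : 0 < form x y := zero_lt_one.trans_le (one_le_form x y)

theorem abs_inner_lt_of_timelike {v : Minkowski n} (hv : 0 < lorentz v v) (x : HypSpace n) :
    |inner ℝ v.1 x.space| < |v.2| * x.time := by
  have h1 := abs_real_inner_le_norm v.1 x.space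
  have hx := x.time_sq
  rw [lorentz_apply, real_inner_self_eq_norm_sq] at hv
  have h2 : ‖v.1‖ < |v.2| := by
    rw [← abs_norm]
    exact sq_lt_sq.1 (by linarith [sq v.2])
  have h3 : ‖x.space‖ < x.time := lt_of_pow_lt_pow_left₀ 2 x.time_pos.le (by linarith)
  nlinarith [norm_nonneg v.1, norm_nonneg x.space]

theorem lorentz_vec_pos {v : Minkowski n} (hv : 0 < lorentz v v) (ht : 0 < v.2)
    (x : HypSpace n) : 0 < lorentz v x.vec := by
  have h := abs_inner_lt_of_timelike hv x
  rw [abs_of_pos ht] at h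
  have := le_abs_self (inner ℝ v.1 x.space)
  rw [lorentz_apply]
  change 0 < v.2 * x.time - inner ℝ v.1 x.space
  linarith

theorem time_pos_of_lorentz_vec_pos {v : Minkowski n} (hv : 0 < lorentz v v) {x : HypSpace n}
    (hx : 0 ≤ lorentz v x.vec) : 0 < v.2 := by
  have h := abs_inner_lt_of_timelike hv x
  by_contra! ht
  rw [abs_of_nonpos ht] at h
  have := neg_abs_le (inner ℝ v.1 x.space)
  have hx' : 0 ≤ v.2 * x.time - inner ℝ v.1 x.space := hx
  linarith

/-- A timelike vector has the same sign against all points of hyperbolic space. -/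
theorem lorentz_vec_pos_of_nonneg {v : Minkowski n} (hv : 0 < lorentz v v) {x : HypSpace n}
    (hx : 0 ≤ lorentz v x.vec) (y : HypSpace n) : 0 < lorentz v y.vec :=
  lorentz_vec_pos hv (time_pos_of_lorentz_vec_pos hv hx) y

theorem exists_vec_eq {v : Minkowski n} (hv : lorentz v v = 1) {x : HypSpace n}
    (hx : 0 ≤ lorentz v x.vec) : ∃ z : HypSpace n, z.vec = v := by
  refine ⟨⟨v.1, v.2, time_pos_of_lorentz_vec_pos (by rw [hv]; exact one_pos) hx, ?_⟩, rfl⟩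
  rw [lorentz_apply, real_inner_self_eq_norm_sq] at hv
  linarith [sq v.2]

theorem lorentz_self_nonpos_of_orthogonal {v : Minkowski n} {x : HypSpace n}
    (h : lorentz v x.vec = 0) : lorentz v v ≤ 0 := by
  by_contra! hv
  exact (lorentz_vec_pos_of_nonneg hv h.ge x).ne' h

theorem eq_zero_of_orthogonal {v : Minkowski n} {x : HypSpace n}
    (h : lorentz v x.vec = 0) (hv : lorentz v v = 0) : v = 0 := by
  have h' : v.2 * x.time - inner ℝ v.1 x.space = 0 := h
  have h1 := norm_sq_le_of_orthogonal x v.1 v.2 (by linarith)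
  rw [lorentz_apply, real_inner_self_eq_norm_sq] at hv
  rw [show ‖v.1‖ ^ 2 - v.2 ^ 2 = 0 by linarith [sq v.2], mul_zero] at h1
  have h2 : ‖v.1‖ ^ 2 = 0 := le_antisymm h1 (sq_nonneg _)
  have h3 : v.2 = 0 := by
    rw [h2] at hv
    exact mul_self_eq_zero.1 (by linarith)
  exact Prod.ext (norm_eq_zero.1 (pow_eq_zero_iff two_ne_zero |>.1 h2)) h3

/-- Cauchy–Schwarz for the negative definite restriction of the form to the tangent space at `x`, by
the discriminant of r ↦ -⟨v + r w, v + r w⟩. -/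
theorem lorentz_sq_le_of_orthogonal {v w : Minkowski n} {x : HypSpace n}
    (hv : lorentz v x.vec = 0) (hw : lorentz w x.vec = 0) :
    lorentz v w ^ 2 ≤ lorentz v v * lorentz w w := by
  have key : ∀ r : ℝ, 0 ≤ (-lorentz w w) * (r * r) + (-2 * lorentz v w) * r
      + (-lorentz v v) := by
    intro r
    have h := lorentz_self_nonpos_of_orthogonal (v := v + r • w) (x := x) (by
      simp [hv, hw])
    simp only [map_add, map_smul, LinearMap.add_apply, LinearMap.smul_apply, smul_eq_mul,
      lorentz_comm w v] at h
    linarith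
  have h := discrim_le_zero key
  unfold discrim at h
  linarith

/-! ### Distances -/

theorem cosh_dist (x y : HypSpace n) : Real.cosh (dist x y) = form x y :=
  Real.cosh_arcosh (one_le_form x y)

theorem form_le_form_iff {x y z w : HypSpace n} :
    form x y ≤ form z w ↔ dist x y ≤ dist z w := by
  rw [← cosh_dist, ← cosh_dist, Real.cosh_le_cosh, abs_of_nonneg dist_nonneg,
    abs_of_nonneg dist_nonneg]

theorem form_map (g : HypSpace n ≃ᵢ HypSpace n) (x y : HypSpace n) :
    form (g x) (g y) = form x y := by
  rw [← cosh_dist, g.dist_eq, cosh_dist]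

theorem dist_eq_of_form_eq {x y : HypSpace n} {t : ℝ} (ht : 0 ≤ t)
    (h : form x y = Real.cosh t) : dist x y = t := by
  rw [dist_def, h, Real.arcosh_cosh ht]

/-! ### Betweenness and geodesic segments -/

/-- `z` lies on the geodesic segment from `x` to `y`. -/
def Btw (x z y : HypSpace n) : Prop := dist x z + dist z y = dist x y

theorem Btw.symm {x z y : HypSpace n} (h : Btw x z y) : Btw y z x := by
  unfold Btw at *
  rw [dist_comm y z, dist_comm z x, dist_comm y x, ← h, add_comm]

theorem btw_left (x y : HypSpace n) : Btw x x y := by simp [Btw]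

theorem btw_right (x y : HypSpace n) : Btw x y y := by simp [Btw]

theorem Btw.map {x z y : HypSpace n} (g : HypSpace n ≃ᵢ HypSpace n) (h : Btw x z y) :
    Btw (g x) (g z) (g y) := by
  simpa only [Btw, g.dist_eq] using h

theorem btw_self_iff {x z : HypSpace n} : Btw x z x ↔ z = x := by
  refine ⟨fun h => ?_, fun h => h ▸ btw_left x x⟩
  unfold Btw at h
  rw [dist_self, dist_comm x z] at h
  exact dist_le_zero.1 (by linarith [dist_nonneg (x := z) (y := x)])

theorem norm_combination {x y z : HypSpace n} {s t : ℝ} (h : z.vec = s • x.vec + t • y.vec) :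
    s ^ 2 + t ^ 2 + 2 * s * t * form x y = 1 := by
  have h1 := form_self z
  rw [← lorentz_vec, h] at h1
  simp only [map_add, map_smul, LinearMap.add_apply, LinearMap.smul_apply, smul_eq_mul,
    lorentz_vec, form_self, form_comm y x] at h1
  linarith

theorem form_combination {x y z : HypSpace n} {s t : ℝ} (h : z.vec = s • x.vec + t • y.vec)
    (w : HypSpace n) : form z w = s * form x w + t * form y w := by
  rw [← lorentz_vec, h]
  simp only [map_add, map_smul, LinearMap.add_apply, LinearMap.smul_apply, smul_eq_mul,
    lorentz_vec]

/-- The combination is itself a point of the hyperboloid, and its form with `z` is 1, which forces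
equality. Linear relations are thus detected by distances alone, which is why isometries preserve
them. -/
theorem eq_combination_of_form {x y z : HypSpace n} {s t : ℝ} (hs : 0 ≤ s) (ht : 0 ≤ t)
    (hn : s ^ 2 + t ^ 2 + 2 * s * t * form x y = 1)
    (h : s * form x z + t * form y z = 1) : z.vec = s • x.vec + t • y.vec := by
  obtain ⟨z', hz'⟩ := exists_vec_eq (v := s • x.vec + t • y.vec) (x := x) (by
      simp only [map_add, map_smul, LinearMap.add_apply, LinearMap.smul_apply, smul_eq_mul,
        lorentz_vec, form_self, form_comm y x]
      linarith) (by
      simp only [map_add, map_smul, LinearMap.add_apply, LinearMap.smul_apply, smul_eq_mul,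
        lorentz_vec]
      have := form_pos x x
      have := form_pos y x
      positivity)
  rw [← hz', eq_of_form_eq_one z z' (by rw [form_comm, form_combination hz', h])]

theorem exists_combination {x y : HypSpace n} {s t : ℝ} (hs : 0 ≤ s) (ht : 0 ≤ t)
    (hn : s ^ 2 + t ^ 2 + 2 * s * t * form x y = 1) :
    ∃ z : HypSpace n, z.vec = s • x.vec + t • y.vec := by
  refine exists_vec_eq (x := x) ?_ ?_
  · simp only [map_add, map_smul, LinearMap.add_apply, LinearMap.smul_apply, smul_eq_mul,
        lorentz_vec, form_self, form_comm y x]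
    linarith
  · simp only [map_add, map_smul, LinearMap.add_apply, LinearMap.smul_apply, smul_eq_mul,
        lorentz_vec]
    have := form_pos x x
    have := form_pos y x
    positivity

/-- Isometries act linearly on combinations of points. -/
theorem map_combination (g : HypSpace n ≃ᵢ HypSpace n) {x y z : HypSpace n} {s t : ℝ}
    (hs : 0 ≤ s) (ht : 0 ≤ t) (h : z.vec = s • x.vec + t • y.vec) :
    (g z).vec = s • (g x).vec + t • (g y).vec := by
  apply eq_combination_of_form hs ht
  · rw [form_map]
    exact norm_combination h
  · rw [form_map, form_map, ← form_combination h, form_self]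

theorem btw_of_combination {x y z : HypSpace n} {s t : ℝ} (hs : 0 ≤ s) (ht : 0 ≤ t)
    (h : z.vec = s • x.vec + t • y.vec) : Btw x z y := by
  have hn := norm_combination h
  have hx : form x z = s + t * form x y := by
    rw [form_comm, form_combination h, form_self, form_comm y x, mul_one]
  have hy : form z y = s * form x y + t := by
    rw [form_combination h, form_self, mul_one]
  have hc := one_le_form x y
  have h0 : 0 ≤ dist x z + dist z y := by positivity
  refine (dist_eq_of_form_eq h0 ?_).symm
  rw [Real.cosh_add, cosh_dist, cosh_dist, dist_def, dist_def, Real.sinh_arcosh (one_le_form _ _),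
    Real.sinh_arcosh (one_le_form _ _), hx, hy]
  have e1 : (s + t * form x y) ^ 2 - 1 = t ^ 2 * (form x y ^ 2 - 1) := by
    linear_combination hn
  have e2 : (s * form x y + t) ^ 2 - 1 = s ^ 2 * (form x y ^ 2 - 1) := by
    linear_combination hn
  rw [e1, e2, Real.sqrt_mul (sq_nonneg _), Real.sqrt_mul (sq_nonneg _), Real.sqrt_sq hs,
    Real.sqrt_sq ht]
  have h1 : √(form x y ^ 2 - 1) * √(form x y ^ 2 - 1) = form x y ^ 2 - 1 :=
    Real.mul_self_sqrt (by nlinarith)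
  linear_combination (-form x y) * hn - s * t * h1

theorem Btw.vec_eq {x y z : HypSpace n} (h : Btw x z y) (hxy : x ≠ y) :
    z.vec = (Real.sinh (dist z y) / Real.sinh (dist x y)) • x.vec
      + (Real.sinh (dist x z) / Real.sinh (dist x y)) • y.vec := by
  have hL : 0 < Real.sinh (dist x y) := Real.sinh_pos_iff.2 (dist_pos.2 hxy)
  unfold Btw at h
  refine eq_combination_of_form ?_ ?_ ?_ ?_
  · exact div_nonneg (Real.sinh_nonneg_iff.2 dist_nonneg) hL.le
  · exact div_nonneg (Real.sinh_nonneg_iff.2 dist_nonneg) hL.le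
  · rw [← cosh_dist]
    field_simp
    rw [← h, Real.sinh_add, Real.cosh_add]
    have h1 := Real.cosh_sq (dist x z)
    have h2 := Real.cosh_sq (dist z y)
    linear_combination (Real.sinh (dist z y)) ^ 2 * (-h1) + (Real.sinh (dist x z)) ^ 2 * (-h2)
  · rw [← cosh_dist, ← cosh_dist, dist_comm y z]
    field_simp
    rw [← h, Real.sinh_add]
    ring

theorem Btw.exists_combination {x y z : HypSpace n} (h : Btw x z y) :
    ∃ s t : ℝ, 0 ≤ s ∧ 0 ≤ t ∧ z.vec = s • x.vec + t • y.vec := by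
  by_cases hxy : x = y
  · subst hxy
    rw [btw_self_iff] at h
    exact ⟨1, 0, zero_le_one, le_rfl, by simp [h]⟩
  · have hL : 0 < Real.sinh (dist x y) := Real.sinh_pos_iff.2 (dist_pos.2 hxy)
    exact ⟨_, _, div_nonneg (Real.sinh_nonneg_iff.2 dist_nonneg) hL.le,
      div_nonneg (Real.sinh_nonneg_iff.2 dist_nonneg) hL.le, h.vec_eq hxy⟩

theorem Btw.eq_of_dist_eq {x y z z' : HypSpace n} (h : Btw x z y) (h' : Btw x z' y)
    (hd : dist x z = dist x z') : z = z' := by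
  by_cases hxy : x = y
  · subst hxy
    rw [btw_self_iff] at h h'
    rw [h, h']
  · apply vec_injective
    have : dist z y = dist z' y := by unfold Btw at h h'; linarith
    rw [h.vec_eq hxy, h'.vec_eq hxy, hd, this]

theorem exists_isGeodesicSegment (x y : HypSpace n) : ∃ S, IsGeodesicSegment x y S := by
  by_cases hxy : x = y
  · subst hxy
    refine ⟨_, 0, fun _ => x, le_rfl, rfl, rfl, fun s hs t ht => ?_, rfl⟩
    simp only [Icc_self, mem_singleton_iff] at hs ht
    simp [hs, ht]
  · set L := dist x y with hL
    have hL0 : 0 < L := dist_pos.2 hxy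
    have hS : 0 < Real.sinh L := Real.sinh_pos_iff.2 hL0
    have hC : form x y = Real.cosh L := (cosh_dist x y).symm
    have hCS := Real.cosh_sq L
    set w : Minkowski n := (Real.sinh L)⁻¹ • (y.vec - Real.cosh L • x.vec) with hw
    have hxw : lorentz x.vec w = 0 := by
      simp only [hw, map_sub, map_smul, smul_eq_mul, lorentz_vec, form_self, hC]
      ring
    have hww : lorentz w w = -1 := by
      simp only [hw, map_sub, map_smul, LinearMap.sub_apply, LinearMap.smul_apply, smul_eq_mul,
        lorentz_vec, form_self, form_comm y x, hC]
      field_simp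
      linear_combination -hCS
    have key : ∀ s t : ℝ, lorentz (Real.cosh s • x.vec + Real.sinh s • w)
        (Real.cosh t • x.vec + Real.sinh t • w) = Real.cosh (s - t) := by
      intro s t
      simp only [map_add, map_smul, LinearMap.add_apply, LinearMap.smul_apply, smul_eq_mul,
        lorentz_vec, form_self, hxw, lorentz_comm w, hww, Real.cosh_sub]
      ring
    have hex : ∀ t : ℝ, ∃ z : HypSpace n, z.vec = Real.cosh t • x.vec + Real.sinh t • w := by
      intro t
      refine exists_vec_eq (x := x) (by rw [key, sub_self, Real.cosh_zero]) ?_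
      simp only [map_add, map_smul, LinearMap.add_apply, LinearMap.smul_apply, smul_eq_mul,
        lorentz_vec, form_self, lorentz_comm w, hxw]
      have := Real.cosh_pos t
      linarith
    choose c hc using hex
    refine ⟨_, L, c, hL0.le, ?_, ?_, fun s _ t _ => ?_, rfl⟩
    · apply vec_injective
      simp [hc]
    · apply vec_injective
      rw [hc, hw, smul_inv_smul₀ hS.ne']
      abel
    · apply dist_eq_of_form_eq (abs_nonneg _)
      rw [← lorentz_vec, hc, hc, key, Real.cosh_abs]

/-- A point between two others is determined by its distance to one of them, so segments are unique
and `Btw` can replace parametrizations from here on. -/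
theorem _root_.IsGeodesicSegment.eq_setOf_btw {x y : HypSpace n} {S : Set (HypSpace n)}
    (h : IsGeodesicSegment x y S) : S = {z | Btw x z y} := by
  obtain ⟨L, c, hL, rfl, rfl, hc, rfl⟩ := h
  have h0 : (0 : ℝ) ∈ Icc 0 L := ⟨le_rfl, hL⟩
  have h1 : L ∈ Icc 0 L := ⟨hL, le_rfl⟩
  have hd : ∀ t ∈ Icc 0 L, dist (c 0) (c t) = t := fun t ht => by
    rw [hc 0 h0 t ht, zero_sub, abs_neg, abs_of_nonneg ht.1]
  have hb : ∀ t ∈ Icc 0 L, Btw (c 0) (c t) (c L) := fun t ht => by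
    rw [Btw, hd t ht, hd L h1, hc t ht L h1, abs_of_nonpos (by linarith [ht.2])]
    ring
  refine Subset.antisymm ?_ fun z hz => ?_
  · rintro _ ⟨t, ht, rfl⟩
    exact hb t ht
  · have hz' : dist (c 0) z + dist z (c L) = dist (c 0) (c L) := hz
    have ht : dist (c 0) z ∈ Icc 0 L :=
      ⟨dist_nonneg, by linarith [dist_nonneg (x := z) (y := c L), hd L h1]⟩
    exact ⟨_, ht, (hb _ ht).eq_of_dist_eq hz (hd _ ht)⟩

theorem exists_btw_dist_eq (x y : HypSpace n) {t : ℝ} (h0 : 0 ≤ t) (ht : t ≤ dist x y) :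
    ∃ z, Btw x z y ∧ dist x z = t := by
  obtain ⟨S, hS⟩ := exists_isGeodesicSegment x y
  have hS' := hS.eq_setOf_btw
  obtain ⟨L, c, hL, rfl, rfl, hc, rfl⟩ := hS
  have m0 : (0 : ℝ) ∈ Icc 0 L := ⟨le_rfl, hL⟩
  rw [hc 0 m0 L ⟨hL, le_rfl⟩, zero_sub, abs_neg, abs_of_nonneg hL] at ht
  refine ⟨c t, ?_, by rw [hc 0 m0 t ⟨h0, ht⟩, zero_sub, abs_neg, abs_of_nonneg h0]⟩
  have : c t ∈ c '' Icc 0 L := ⟨t, ⟨h0, ht⟩, rfl⟩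
  rwa [hS'] at this

theorem geodesicallyConvex_iff {A : Set (HypSpace n)} :
    GeodesicallyConvex A ↔ ∀ x ∈ A, ∀ y ∈ A, ∀ z, Btw x z y → z ∈ A := by
  constructor
  · intro h x hx y hy z hz
    obtain ⟨S, hS⟩ := exists_isGeodesicSegment x y
    refine h x hx y hy S hS ?_
    rw [hS.eq_setOf_btw]
    exact hz
  · intro h x hx y hy S hS z hz
    rw [hS.eq_setOf_btw] at hz
    exact h x hx y hy z hz

/-- Two points of a segment are at distance the difference of their distances to an endpoint. -/
theorem Btw.dist_eq_abs {x y z w : HypSpace n} (hz : Btw x z y) (hw : Btw x w y) :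
    dist z w = |dist x z - dist x w| := by
  obtain ⟨S, hS⟩ := exists_isGeodesicSegment x y
  have hS' := hS.eq_setOf_btw
  obtain ⟨L, c, hL, rfl, rfl, hc, rfl⟩ := hS
  have hz' : z ∈ c '' Icc 0 L := by rw [hS']; exact hz
  have hw' : w ∈ c '' Icc 0 L := by rw [hS']; exact hw
  obtain ⟨s, hs, rfl⟩ := hz'
  obtain ⟨t, ht, rfl⟩ := hw'
  have m0 : (0 : ℝ) ∈ Icc 0 L := ⟨le_rfl, hL⟩
  rw [hc s hs t ht, hc 0 m0 s hs, hc 0 m0 t ht, zero_sub, zero_sub, abs_neg, abs_neg,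
    abs_of_nonneg hs.1, abs_of_nonneg ht.1]

theorem geodesicallyConvex_segment {x y : HypSpace n} {S : Set (HypSpace n)}
    (h : IsGeodesicSegment x y S) : GeodesicallyConvex S := by
  rw [geodesicallyConvex_iff]
  intro a ha b hb z hz
  rw [h.eq_setOf_btw] at ha hb ⊢
  have hab := Btw.dist_eq_abs ha hb
  change Btw x a y at ha
  change Btw x b y at hb
  change Btw x z y
  unfold Btw at *
  have t1 := dist_triangle x a z
  have t2 := dist_triangle z b y
  have t3 := dist_triangle x b z
  have t4 := dist_triangle z a y
  have t5 := dist_triangle x z y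
  rw [dist_comm b z] at t3
  rw [dist_comm z a] at t4
  rcases abs_cases (dist x a - dist x b) with h | h <;> linarith

/-! ### Thin triangles -/

/-- Since exp t / 2 ≤ cosh t ≤ exp t for t ≥ 0, each of the two factors on the left costs a 2, and 8
= 2 · 2 · 2. -/
theorem dist_add_dist_le_of_form {x z w : HypSpace n}
    (h : form x z * form z w ≤ 2 * form x w) :
    dist x z + dist z w ≤ dist x w + Real.log 8 := by
  rw [← cosh_dist, ← cosh_dist, ← cosh_dist] at h
  have h1 : ∀ t : ℝ, Real.exp t ≤ 2 * Real.cosh t := fun t => by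
    rw [Real.cosh_eq]; linarith [Real.exp_pos (-t)]
  have h2 : Real.cosh (dist x w) ≤ Real.exp (dist x w) := by
    rw [Real.cosh_eq]
    have := Real.exp_le_exp.2 (show -dist x w ≤ dist x w by
      linarith [dist_nonneg (x := x) (y := w)])
    linarith
  rw [← Real.exp_le_exp, Real.exp_add, Real.exp_add, Real.exp_log (by norm_num)]
  have h3 := mul_le_mul (h1 (dist x z)) (h1 (dist z w)) (Real.exp_pos _).le
    (by linarith [Real.cosh_pos (dist x z)])
  linarith

/-- With z = s x + t y, the larger of the two terms of `form z w` is at least half of it, and the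
normalization of `z` gives s · `form x z` ≤ 1 and t · `form y z` ≤ 1. -/
theorem Btw.approx {x y z : HypSpace n} (h : Btw x z y) (w : HypSpace n) :
    dist x z + dist z w ≤ dist x w + Real.log 8 ∨
      dist y z + dist z w ≤ dist y w + Real.log 8 := by
  obtain ⟨s, t, hs, ht, hz⟩ := h.exists_combination
  have hn := norm_combination hz
  have hw := form_combination hz w
  have hx : s * form z x ≤ 1 := by
    rw [form_combination hz, form_self, form_comm y x]
    nlinarith [mul_nonneg (mul_nonneg hs ht) (form_pos x y).le]
  have hy : t * form z y ≤ 1 := by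
    rw [form_combination hz, form_self]
    nlinarith [mul_nonneg (mul_nonneg hs ht) (form_pos x y).le]
  rw [form_comm] at hx hy
  have px := form_pos x z
  have py := form_pos y z
  rcases le_total (s * form x w) (t * form y w) with h | h
  · right
    apply dist_add_dist_le_of_form
    nlinarith [form_pos y w]
  · left
    apply dist_add_dist_le_of_form
    nlinarith [form_pos x w]

/-- The thinness constant of triangles. -/
noncomputable def thinConst : ℝ := 2 * Real.log 8

theorem thinConst_pos : 0 < thinConst := mul_pos two_pos (Real.log_pos (by norm_num))

theorem exists_btw_near {x z w : HypSpace n}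
    (h : dist x z + dist z w ≤ dist x w + Real.log 8) :
    ∃ z', Btw x z' w ∧ dist z z' ≤ thinConst := by
  have h8 : 0 < Real.log 8 := Real.log_pos (by norm_num)
  unfold thinConst
  rcases le_total (dist x z) (dist x w) with hle | hle
  · obtain ⟨z', hz', hd⟩ := exists_btw_dist_eq x w dist_nonneg hle
    refine ⟨z', hz', ?_⟩
    have hb : dist x z' + dist z' w = dist x w := hz'
    -- The point z' is as far from x as z is. Here `Btw.approx` is applied to z' on [x, w] with
    -- third point z; its second alternative adds the error in the hypothesis, hence the constant 2
    -- log 8.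
    rcases hz'.approx z with h' | h'
    · rw [dist_comm z z']; linarith
    · rw [dist_comm z z']
      rw [dist_comm w z', dist_comm w z] at h'
      linarith
  · exact ⟨w, btw_right x w, by linarith⟩

theorem Btw.thin {x y z : HypSpace n} (h : Btw x z y) (w : HypSpace n) :
    ∃ z', (Btw x z' w ∨ Btw w z' y) ∧ dist z z' ≤ thinConst := by
  rcases h.approx w with h' | h'
  · obtain ⟨z', hz', hd⟩ := exists_btw_near h'
    exact ⟨z', Or.inl hz', hd⟩
  · obtain ⟨z', hz', hd⟩ := exists_btw_near h'
    exact ⟨z', Or.inr hz'.symm, hd⟩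

theorem Btw.thin_quadrilateral {x y z : HypSpace n} (h : Btw x z y) (v w : HypSpace n) :
    ∃ z', (Btw x z' v ∨ Btw v z' w ∨ Btw w z' y) ∧ dist z z' ≤ 2 * thinConst := by
  have hp := thinConst_pos
  obtain ⟨z₁, h₁ | h₁, hd₁⟩ := h.thin v
  · exact ⟨z₁, Or.inl h₁, by linarith⟩
  · obtain ⟨z₂, h₂, hd₂⟩ := h₁.thin w
    exact ⟨z₂, Or.inr h₂, by linarith [dist_triangle z z₁ z₂]⟩

end HypSpace

namespace HypSpace

variable {n : ℕ}

/-! ### Nearest points -/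

theorem continuous_form_comp {α : Type*} [TopologicalSpace α] {f g : α → HypSpace n}
    (hf : Continuous f) (hg : Continuous g) : Continuous fun a => form (f a) (g a) := by
  simp only [← cosh_dist]
  exact Real.continuous_cosh.comp (hf.dist hg)

theorem dist_sq_le (x y : HypSpace n) : dist x y ^ 2 ≤ 2 * (form x y - 1) := by
  rw [← cosh_dist, show dist x y = 2 * (dist x y / 2) by ring, Real.cosh_two_mul, Real.cosh_sq]
  have h : dist x y / 2 ≤ Real.sinh (dist x y / 2) :=
    Real.self_le_sinh_iff.2 (by positivity)
  have h0 : 0 ≤ dist x y / 2 := by positivity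
  nlinarith

theorem tendsto_of_tendsto_space {ι : Type*} {l : Filter ι} {u : ι → HypSpace n}
    {z : HypSpace n} (h : Filter.Tendsto (fun i => (u i).space) l (𝓝 z.space)) :
    Filter.Tendsto u l (𝓝 z) := by
  have ht : ∀ x : HypSpace n, x.time = √(1 + ‖x.space‖ ^ 2) := fun x => by
    rw [← x.time_sq, Real.sqrt_sq x.time_pos.le]
  have h1 : Filter.Tendsto (fun i => (u i).time) l (𝓝 z.time) := by
    simp only [ht]
    exact ((h.norm.pow 2).const_add 1).sqrt
  have h2 : Filter.Tendsto (fun i => form (u i) z) l (𝓝 (form z z)) :=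
    (h1.mul_const _).sub (h.inner tendsto_const_nhds)
  rw [form_self] at h2
  rw [tendsto_iff_dist_tendsto_zero]
  have h3 := (((h2.sub_const 1).const_mul 2).sqrt)
  simp only [sub_self, mul_zero, Real.sqrt_zero] at h3
  refine squeeze_zero (fun _ => dist_nonneg) (fun i => ?_) h3
  exact Real.le_sqrt_of_sq_le (dist_sq_le _ _)

instance : ProperSpace (HypSpace n) := by
  refine ⟨fun x r => IsSeqCompact.isCompact fun u hu => ?_⟩
  let o : HypSpace n := ⟨0, 1, one_pos, by simp⟩
  have hb : ∀ i, (u i).space ∈ Metric.closedBall (0 : EuclideanSpace ℝ (Fin n))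
      (Real.cosh (r + dist x o)) := fun i => by
    rw [mem_closedBall_zero_iff]
    have h1 : (u i).time = Real.cosh (dist (u i) o) := by
      rw [cosh_dist]
      simp [form, o]
    have h2 : dist (u i) o ≤ r + dist x o :=
      (dist_triangle _ x _).trans (by gcongr; exact hu i)
    have h3 : (u i).time ≤ Real.cosh (r + dist x o) := by
      rw [h1, Real.cosh_le_cosh, abs_of_nonneg dist_nonneg]
      exact h2.trans (le_abs_self _)
    refine le_trans ?_ h3
    exact le_of_sq_le_sq (by linarith [(u i).time_sq]) (u i).time_pos.le
  obtain ⟨s, -, φ, hφ, hs⟩ := tendsto_subseq_of_bounded Metric.isBounded_closedBall hb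
  let z : HypSpace n := ⟨s, √(1 + ‖s‖ ^ 2), by positivity, Real.sq_sqrt (by positivity)⟩
  have hz : Filter.Tendsto (u ∘ φ) Filter.atTop (𝓝 z) := tendsto_of_tendsto_space (z := z) hs
  exact ⟨z, Metric.isClosed_closedBall.mem_of_tendsto hz (.of_forall fun i => hu (φ i)),
    φ, hφ, hz⟩

/-- `a` is a point of `C` nearest to `q`. -/
def IsNearest (C : Set (HypSpace n)) (q a : HypSpace n) : Prop :=
  a ∈ C ∧ ∀ z ∈ C, dist q a ≤ dist q z

theorem exists_isNearest {C : Set (HypSpace n)} (hC : IsClosed C) (hne : C.Nonempty)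
    (q : HypSpace n) : ∃ a, IsNearest C q a := by
  obtain ⟨a, ha, h⟩ := hC.exists_infDist_eq_dist hne q
  exact ⟨a, ha, fun z hz => h ▸ Metric.infDist_le_dist_of_mem hz⟩

/-- The angle at the nearest point is not acute. -/
theorem IsNearest.form_mul_form_le {C : Set (HypSpace n)} (hC : GeodesicallyConvex C)
    {q a : HypSpace n} (h : IsNearest C q a) {z : HypSpace n} (hz : z ∈ C) :
    form q a * form a z ≤ form q z := by
  rw [geodesicallyConvex_iff] at hC
  set A := form q a with hA
  set Z := form q z with hZ
  set c := form a z with hc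
  have hA1 : 1 ≤ A := one_le_form q a
  have hZ1 : 1 ≤ Z := one_le_form q z
  have hc1 : 1 ≤ c := one_le_form a z
  -- First variation: the point (a + t z) / N of [a, z] is no closer to q than a. Squaring and
  -- cancelling one factor t leaves terms linear in t, which vanish as t → 0.
  have key : ∀ t : ℝ, 0 < t → 2 * A ^ 2 * c + A ^ 2 * t ≤ 2 * A * Z + Z ^ 2 * t := by
    intro t ht
    set N := √(1 + t ^ 2 + 2 * t * c) with hN
    have hN2 : N ^ 2 = 1 + t ^ 2 + 2 * t * c := Real.sq_sqrt (by positivity)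
    have hN0 : 0 < N := Real.sqrt_pos.2 (by positivity)
    have hn : (1 / N) ^ 2 + (t / N) ^ 2 + 2 * (1 / N) * (t / N) * form a z = 1 := by
      rw [← hc]
      field_simp
      linarith
    obtain ⟨w, hw⟩ := exists_combination (by positivity) (by positivity) hn
    have hwC := hC a h.1 z hz w (btw_of_combination (by positivity) (by positivity) hw)
    have h1 := form_le_form_iff.2 (h.2 w hwC)
    rw [form_comm q w, form_combination hw, form_comm a q, form_comm z q, ← hA, ← hZ] at h1
    have h2 : A * N ≤ A + t * Z := by
      have := mul_le_mul_of_nonneg_right h1 hN0.le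
      field_simp at this
      linarith
    have h3 : (A * N) ^ 2 ≤ (A + t * Z) ^ 2 := by gcongr
    rw [mul_pow, hN2] at h3
    have h4 : t * (2 * A ^ 2 * c + A ^ 2 * t) ≤ t * (2 * A * Z + Z ^ 2 * t) := by linarith
    exact le_of_mul_le_mul_left h4 ht
  have h0 : 2 * A ^ 2 * c ≤ 2 * A * Z := by
    refine le_of_forall_pos_le_add fun e he => ?_
    have h1 := key (e / Z ^ 2) (by positivity)
    rw [mul_div_cancel₀ _ (by positivity : Z ^ 2 ≠ 0)] at h1
    have : 0 ≤ A ^ 2 * (e / Z ^ 2) := by positivity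
    linarith
  nlinarith

theorem IsNearest.unique {C : Set (HypSpace n)} (hC : GeodesicallyConvex C)
    {q a b : HypSpace n} (ha : IsNearest C q a) (hb : IsNearest C q b) : a = b := by
  have h := ha.form_mul_form_le hC hb.1
  have h' := form_le_form_iff.2 (hb.2 a ha.1)
  apply eq_of_form_eq_one
  have := one_le_form a b
  have := form_pos q a
  nlinarith

theorem IsNearest.map {C : Set (HypSpace n)} {g : HypSpace n ≃ᵢ HypSpace n}
    (hg : ∀ z ∈ C, g z ∈ C) (hg' : ∀ z ∈ C, g.symm z ∈ C) {q a : HypSpace n}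
    (h : IsNearest C q a) : IsNearest C (g q) (g a) := by
  refine ⟨hg _ h.1, fun z hz => ?_⟩
  have := h.2 _ (hg' z hz)
  rwa [g.dist_eq, ← g.apply_symm_apply z, g.dist_eq]

theorem IsNearest.of_btw {C : Set (HypSpace n)} {q p a : HypSpace n}
    (h : IsNearest C q a) (hp : Btw q p a) : IsNearest C p a := by
  refine ⟨h.1, fun z hz => ?_⟩
  have h1 := h.2 z hz
  have h2 := dist_triangle q p z
  unfold Btw at hp
  linarith

/-- In a quadrilateral with two right or obtuse angles on its base and legs of the same length,
the opposite side is longer than the base. -/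
theorem form_sub_one_le_of_obtuse {q q' a b : HypSpace n} {h : ℝ} (hq : form q a = h)
    (hq' : form q' b = h) (h1 : h * form a b ≤ form q b) (h2 : h * form a b ≤ form q' a) :
    h ^ 2 * (form a b - 1) ≤ form q q' - 1 := by
  have hh : 1 ≤ h := hq ▸ one_le_form q a
  -- The vectors q - h a and q' - h b are orthogonal to a and b and have square 1 - h². If the bound
  -- failed, their difference would be timelike, yet nonnegative against b and nonpositive against
  -- a.
  have key : 1 - h ^ 2 ≤ lorentz (q.vec - h • a.vec) (q'.vec - h • b.vec) := by
    by_contra! hlt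
    have hb : 0 ≤ lorentz ((q.vec - h • a.vec) - (q'.vec - h • b.vec)) b.vec := by
      simp only [map_sub, map_smul, LinearMap.sub_apply, LinearMap.smul_apply, smul_eq_mul,
        lorentz_vec, form_self, hq']
      linarith
    have hv : 0 < lorentz ((q.vec - h • a.vec) - (q'.vec - h • b.vec))
        ((q.vec - h • a.vec) - (q'.vec - h • b.vec)) := by
      simp only [map_sub, map_smul, LinearMap.sub_apply, LinearMap.smul_apply, smul_eq_mul,
        lorentz_vec, form_self, hq, hq', form_comm a q, form_comm b q', form_comm q' q,
        form_comm b q, form_comm q' a, form_comm b a] at hlt ⊢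
      linarith
    have ha := lorentz_vec_pos_of_nonneg hv hb a
    simp only [map_sub, map_smul, LinearMap.sub_apply, LinearMap.smul_apply, smul_eq_mul,
      lorentz_vec, form_self, hq, form_comm b a] at ha
    linarith
  simp only [map_sub, map_smul, LinearMap.sub_apply, LinearMap.smul_apply, smul_eq_mul,
    lorentz_vec, form_comm a q'] at key
  nlinarith

/-- Displacements grow away from an invariant convex set. -/
theorem IsNearest.form_map_sub_one_le {C : Set (HypSpace n)} (hC : GeodesicallyConvex C)
    {g : HypSpace n ≃ᵢ HypSpace n} (hg : ∀ z ∈ C, g z ∈ C) (hg' : ∀ z ∈ C, g.symm z ∈ C)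
    {q a : HypSpace n} (h : IsNearest C q a) :
    form q a ^ 2 * (form a (g a) - 1) ≤ form q (g q) - 1 := by
  have h1 := h.form_mul_form_le hC (hg a h.1)
  have h2 := (h.map hg hg').form_mul_form_le hC h.1
  rw [form_map, form_comm (g a) a] at h2
  exact form_sub_one_le_of_obtuse rfl (form_map g q a) h1 h2

/-! ### Isometries with displacement bounded below -/

/-- This vanishes if and only if `x`, `g x`, `g (g x)` lie in this order on a geodesic. -/
noncomputable def bend (g : HypSpace n ≃ᵢ HypSpace n) (x : HypSpace n) : ℝ :=
  2 * form x (g x) ^ 2 - 1 - form x (g (g x))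

theorem bend_map {g f : HypSpace n ≃ᵢ HypSpace n} (hfg : ∀ x, f (g x) = g (f x))
    (x : HypSpace n) : bend g (f x) = bend g x := by
  unfold bend
  rw [← hfg, ← hfg, form_map, form_map]

theorem continuous_bend (g : HypSpace n ≃ᵢ HypSpace n) : Continuous (bend g) := by
  have h1 := continuous_form_comp (n := n) continuous_id g.continuous
  have h2 := continuous_form_comp (n := n) continuous_id (g.continuous.comp g.continuous)
  exact (((h1.pow 2).const_mul 2).sub continuous_const).sub h2

/-- The deviation of three successive orbit points from being collinear. -/
noncomputable def bendVec (g : HypSpace n ≃ᵢ HypSpace n) (x : HypSpace n) : Minkowski n :=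
  x.vec + (g (g x)).vec - (2 * form x (g x)) • (g x).vec

theorem lorentz_bendVec_left (g : HypSpace n ≃ᵢ HypSpace n) (x : HypSpace n) :
    lorentz (bendVec g x) (g x).vec = 0 := by
  simp only [bendVec, map_sub, map_add, map_smul, LinearMap.sub_apply, LinearMap.add_apply,
    LinearMap.smul_apply, smul_eq_mul, lorentz_vec, form_self, form_comm (g (g x)), form_map]
  ring

/-- As `bendVec` is tangent at `g x`, where the form is negative definite, the bend is nonnegative
and vanishes only if `bendVec` does. -/
theorem lorentz_bendVec_self (g : HypSpace n ≃ᵢ HypSpace n) (x : HypSpace n) :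
    lorentz (bendVec g x) (bendVec g x) = -(2 * bend g x) := by
  simp only [bend, bendVec, map_sub, map_add, map_smul, LinearMap.sub_apply,
    LinearMap.add_apply, LinearMap.smul_apply, smul_eq_mul, lorentz_vec, form_self,
    form_comm (g (g x)), form_comm (g x) x, form_map]
  ring

theorem bend_nonneg (g : HypSpace n ≃ᵢ HypSpace n) (x : HypSpace n) : 0 ≤ bend g x := by
  have h := lorentz_self_nonpos_of_orthogonal (lorentz_bendVec_left g x)
  rw [lorentz_bendVec_self] at h
  linarith

/-- Cauchy–Schwarz in the tangent space at `g x`, applied to two successive bend vectors, the second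
one projected by adding k times `g x`. This is what bounds the bend at the midpoint. -/
theorem le_form_iterate_three (g : HypSpace n ≃ᵢ HypSpace n) (x : HypSpace n) :
    form x (g x) + 4 * form x (g x) * form x (g (g x)) - 4 * form x (g x) ^ 3
      - 2 * bend g x - bend g x ^ 2 / 2 ≤ form x (g (g (g x))) := by
  set k := bend g x with hk
  have hk0 : 0 ≤ k := bend_nonneg g x
  have hk' : k = 2 * form x (g x) ^ 2 - 1 - form x (g (g x)) := rfl
  have e1 : lorentz (bendVec g (g x)) (g x).vec = -k := by
    simp only [hk', bendVec, map_sub, map_add, map_smul, LinearMap.sub_apply,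
      LinearMap.add_apply, LinearMap.smul_apply, smul_eq_mul, lorentz_vec, form_self,
      form_comm (g (g (g x))), form_comm (g (g x)) (g x), form_map]
    ring
  have e2 : lorentz (bendVec g (g x)) (bendVec g (g x)) = -(2 * k) := by
    rw [lorentz_bendVec_self, bend_map (fun _ => rfl)]
  have e3 : lorentz (bendVec g x) (bendVec g (g x)) = form x (g (g (g x))) - form x (g x)
      - 4 * form x (g x) * form x (g (g x)) + 4 * form x (g x) ^ 3 := by
    simp only [bendVec, map_sub, map_add, map_smul, LinearMap.sub_apply,
      LinearMap.add_apply, LinearMap.smul_apply, smul_eq_mul, lorentz_vec, form_self,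
      form_comm (g (g x)) (g x), form_map]
    ring
  have h := lorentz_sq_le_of_orthogonal (v := bendVec g x)
    (w := bendVec g (g x) + k • (g x).vec) (lorentz_bendVec_left g x) (by
      simp [e1, lorentz_vec, form_self])
  simp only [map_add, map_smul, LinearMap.add_apply, LinearMap.smul_apply, smul_eq_mul,
    lorentz_bendVec_left, lorentz_bendVec_self, lorentz_vec, form_self, e1, e2,
    lorentz_comm (g x).vec, ← hk, mul_zero, add_zero] at h
  have h' : lorentz (bendVec g x) (bendVec g (g x)) ^ 2 ≤ (2 * k + k ^ 2 / 2) ^ 2 := by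
    nlinarith [pow_nonneg hk0 3, pow_nonneg hk0 4]
  have h'' := (abs_le_of_sq_le_sq' h' (by positivity)).1
  rw [e3] at h''
  linarith

theorem exists_midpoint (x y : HypSpace n) :
    ∃ m : HypSpace n, m.vec = (1 / √(2 * (1 + form x y))) • x.vec
      + (1 / √(2 * (1 + form x y))) • y.vec := by
  have h := form_pos x y
  apply exists_combination (by positivity) (by positivity)
  have h2 : √(2 * (1 + form x y)) ^ 2 = 2 * (1 + form x y) := Real.sq_sqrt (by positivity)
  have h0 : 0 < √(2 * (1 + form x y)) := Real.sqrt_pos.2 (by positivity)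
  field_simp
  linarith

/-- The midpoint between `x` and `g x` has a smaller displacement and a smaller bend. -/
theorem bend_midpoint {g : HypSpace n ≃ᵢ HypSpace n} {x m : HypSpace n}
    (hm : m.vec = (1 / √(2 * (1 + form x (g x)))) • x.vec
      + (1 / √(2 * (1 + form x (g x)))) • (g x).vec) :
    form m (g m) = form x (g x) - bend g x / (2 * (1 + form x (g x))) ∧
      2 * (1 + form x (g x)) * bend g m ≤ (4 + bend g x) * bend g x := by
  have hc1 := one_le_form x (g x)
  have hk0 := bend_nonneg g x
  have hk : bend g x = 2 * form x (g x) ^ 2 - 1 - form x (g (g x)) := rfl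
  have h3 := le_form_iterate_three g x
  set s := √(2 * (1 + form x (g x))) with hs
  have hs2 : s ^ 2 = 2 * (1 + form x (g x)) := Real.sq_sqrt (by positivity)
  have hs0 : 0 < s := Real.sqrt_pos.2 (by positivity)
  have hm1 := map_combination g (by positivity) (by positivity) hm
  have hm2 := map_combination g (by positivity) (by positivity) hm1
  have f1 : form m (g m) * s ^ 2 = 2 * form x (g x) + 1 + form x (g (g x)) := by
    rw [form_combination hm, form_comm x, form_comm (g x), form_combination hm1,
      form_combination hm1, form_self, form_comm (g (g x)) (g x), form_map,
      form_comm (g x) x, form_comm (g (g x)) x]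
    field_simp
    ring
  have f2 : form m (g (g m)) * s ^ 2
      = form x (g x) + 2 * form x (g (g x)) + form x (g (g (g x))) := by
    rw [form_combination hm, form_comm x, form_comm (g x), form_combination hm2,
      form_combination hm2, form_comm (g (g x)) (g x), form_comm (g (g (g x))) (g x), form_map,
      form_map, form_comm (g (g x)) x, form_comm (g (g (g x))) x]
    field_simp
    ring
  have f1' : form m (g m) = form x (g x) - bend g x / (2 * (1 + form x (g x))) := by
    rw [eq_sub_iff_add_eq, ← hs2]
    field_simp
    rw [f1, hs2, hk]
    ring
  refine ⟨f1', ?_⟩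
  have hkm : bend g m = 2 * form m (g m) ^ 2 - 1 - form m (g (g m)) := rfl
  set c := form x (g x)
  set k := bend g x
  have hd : (k / (2 * (1 + c))) * (2 * (1 + c)) = k := div_mul_cancel₀ _ (by positivity)
  have hdk : k / (2 * (1 + c)) * 4 ≤ k := by
    have : 0 ≤ k / (2 * (1 + c)) := by positivity
    nlinarith
  rw [hkm, f1']
  set d := k / (2 * (1 + c))
  rw [hs2] at f2
  have hd0 : 0 ≤ d := by positivity
  have h4 : 2 * (1 + c) * d ^ 2 * 4 ≤ k ^ 2 := by
    calc 2 * (1 + c) * d ^ 2 * 4 = (d * (2 * (1 + c))) * (d * 4) := by ring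
      _ = k * (d * 4) := by rw [hd]
      _ ≤ k * k := by gcongr
      _ = k ^ 2 := by ring
  have e : 2 * (1 + c) * (2 * (c - d) ^ 2 - 1) = 2 * (1 + c) * (2 * c ^ 2 - 1)
      - 4 * c * k + 2 * (2 * (1 + c) * d ^ 2) := by
    linear_combination (-4 * c) * hd
  nlinarith

/-- Two midpoint steps advance along the orbit by about one application of `g`, so the result is
compared with `g x` and not with `x`; `exists_bend_le` then pulls it back by the inverse of `g`. -/
theorem dist_midpoint_midpoint {g : HypSpace n ≃ᵢ HypSpace n} {x m m' : HypSpace n}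
    (hm : m.vec = (1 / √(2 * (1 + form x (g x)))) • x.vec
      + (1 / √(2 * (1 + form x (g x)))) • (g x).vec)
    (hm' : m'.vec = (1 / √(2 * (1 + form m (g m)))) • m.vec
      + (1 / √(2 * (1 + form m (g m)))) • (g m).vec) :
    dist (g x) m' ≤ √(bend g x) / 2 := by
  have hc1 := one_le_form x (g x)
  have hc1' := one_le_form m (g m)
  have hk0 := bend_nonneg g x
  have hc' := (bend_midpoint hm).1
  set k := bend g x
  set c := form x (g x) with hc
  set c' := form m (g m) with hcc'
  set s := √(2 * (1 + c)) with hs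
  set s' := √(2 * (1 + c')) with hs'
  have hs2 : s ^ 2 = 2 * (1 + c) := Real.sq_sqrt (by positivity)
  have hs0 : 0 < s := Real.sqrt_pos.2 (by positivity)
  have hs2' : s' ^ 2 = 2 * (1 + c') := Real.sq_sqrt (by positivity)
  have hs0' : 0 < s' := Real.sqrt_pos.2 (by positivity)
  have hm1 := map_combination g (by positivity) (by positivity) hm
  have hf : form (g x) m' = s / s' := by
    rw [form_comm, form_combination hm', form_combination hm, form_combination hm1, form_self,
      form_comm (g (g x)), form_map, ← hc]
    field_simp
    linarith
  have hf1 := one_le_form (g x) m'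
  have hff : form (g x) m' ^ 2 ≤ 1 + k / 8 := by
    rw [hf, div_pow, hs2, hs2', div_le_iff₀ (by positivity)]
    have hd : k / (2 * (1 + c)) * 4 ≤ k := by
      have h0 : 0 ≤ k / (2 * (1 + c)) := by positivity
      have : (k / (2 * (1 + c))) * (2 * (1 + c)) = k := div_mul_cancel₀ _ (by positivity)
      nlinarith
    nlinarith
  have hd2 : dist (g x) m' ^ 2 ≤ k / 4 := (dist_sq_le _ _).trans (by nlinarith)
  rw [show √k / 2 = √(k / 4) by
    rw [Real.sqrt_div' _ (by norm_num), show (4 : ℝ) = 2 ^ 2 by norm_num,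
      Real.sqrt_sq (by norm_num)]]
  exact Real.le_sqrt_of_sq_le hd2

theorem exists_bend_le {g : HypSpace n ≃ᵢ HypSpace n} {c θ : ℝ} (hc : 1 ≤ c)
    (hg : ∀ z, c ≤ form z (g z)) (hθ : θ = (3 + c) / (2 + 2 * c)) {x : HypSpace n}
    (hx : bend g x ≤ c - 1) :
    ∃ x', bend g x' ≤ θ * bend g x ∧ dist x x' ≤ √(bend g x) / 2 := by
  have hθ0 : 0 ≤ θ := by rw [hθ]; positivity
  have hθ1 : θ ≤ 1 := by
    rw [hθ, div_le_one (by positivity)]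
    linarith
  have key : ∀ y m : HypSpace n, bend g y ≤ c - 1 →
      m.vec = (1 / √(2 * (1 + form y (g y)))) • y.vec
        + (1 / √(2 * (1 + form y (g y)))) • (g y).vec → bend g m ≤ θ * bend g y := by
    intro y m hy hm
    have h := (bend_midpoint hm).2
    have h0 := bend_nonneg g y
    have h0' := bend_nonneg g m
    have h1 := hg y
    -- The factor 4 + `bend g y` is at most 3 + c, which explains θ; it is less than 1 once c > 1.
    have h2 : (2 + 2 * c) * bend g m ≤ (3 + c) * bend g y := by nlinarith
    rw [hθ, div_mul_eq_mul_div, le_div_iff₀ (by positivity)]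
    linarith
  obtain ⟨m, hm⟩ := exists_midpoint x (g x)
  obtain ⟨m', hm'⟩ := exists_midpoint m (g m)
  have h1 := key x m hx hm
  have h0 := bend_nonneg g x
  have h0' := bend_nonneg g m
  have h2 := key m m' (by nlinarith) hm'
  refine ⟨g.symm m', ?_, ?_⟩
  · rw [bend_map (fun z => by simp)]
    nlinarith
  · rw [← g.dist_eq, g.apply_symm_apply]
    exact dist_midpoint_midpoint hm hm'

theorem exists_bend_eq_zero {g : HypSpace n ≃ᵢ HypSpace n} {c : ℝ} (hc : 1 < c)
    (hg : ∀ z, c ≤ form z (g z)) : ∃ x, bend g x = 0 := by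
  obtain ⟨x₀, hx₀⟩ : ∃ x, bend g x ≤ c - 1 := by
    set I := ⨅ z : HypSpace n, form z (g z) with hI
    have hbdd : BddBelow (range fun z : HypSpace n => form z (g z)) :=
      ⟨c, by rintro _ ⟨z, rfl⟩; exact hg z⟩
    have : Nonempty (HypSpace n) := ⟨⟨0, 1, one_pos, by simp⟩⟩
    have hI1 : c ≤ I := le_ciInf hg
    -- Passing to the midpoint lowers the displacement by bend / (2 (1 + form)), so an η-almost
    -- minimizer has bend at most η · 2 (2 + I) ≤ c - 1.
    set η := min 1 ((c - 1) / (2 * (2 + I))) with hη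
    have hη0 : 0 < η := lt_min one_pos (div_pos (by linarith) (by linarith))
    obtain ⟨x, hx⟩ := exists_lt_of_ciInf_lt (show I < I + η by linarith)
    refine ⟨x, ?_⟩
    obtain ⟨m, hm⟩ := exists_midpoint x (g x)
    have h1 := (bend_midpoint hm).1
    have h2 : I ≤ form m (g m) := ciInf_le hbdd m
    have h3 : bend g x / (2 * (1 + form x (g x))) ≤ η := by linarith
    have hc1 := form_pos x (g x)
    rw [div_le_iff₀ (by positivity)] at h3
    have h4 : η * (2 * (2 + I)) ≤ c - 1 := by
      rw [← le_div_iff₀ (by linarith)]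
      exact min_le_right _ _
    have h5 : η ≤ 1 := min_le_left _ _
    nlinarith
  set θ := (3 + c) / (2 + 2 * c) with hθ
  have hθ0 : 0 ≤ θ := by positivity
  have hθ1 : θ < 1 := by
    rw [hθ, div_lt_one (by positivity)]
    linarith
  have hstep : ∀ x : {x : HypSpace n // bend g x ≤ c - 1},
      ∃ x' : {x : HypSpace n // bend g x ≤ c - 1}, bend g x'.1 ≤ θ * bend g x.1 ∧
        dist x.1 x'.1 ≤ √(bend g x.1) / 2 := by
    rintro ⟨x, hx⟩
    obtain ⟨x', h1, h2⟩ := exists_bend_le hc.le hg hθ hx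
    exact ⟨⟨x', h1.trans (by nlinarith [bend_nonneg g x])⟩, h1, h2⟩
  choose T hT1 hT2 using hstep
  let u : ℕ → {x : HypSpace n // bend g x ≤ c - 1} := fun i => T^[i] ⟨x₀, hx₀⟩
  have hu : ∀ i, u (i + 1) = T (u i) := fun i => Function.iterate_succ_apply' T i _
  have hub : ∀ i, bend g (u i).1 ≤ θ ^ i * (c - 1) := by
    intro i
    induction i with
    | zero => simpa [u] using hx₀
    | succ i ih =>
      rw [hu, pow_succ', mul_assoc]
      exact (hT1 _).trans (by gcongr)
  have hud : ∀ i, dist (u i).1 (u (i + 1)).1 ≤ (√(c - 1) / 2) * √θ ^ i := by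
    intro i
    rw [hu]
    refine (hT2 _).trans ?_
    have : √(bend g (u i).1) ≤ √(θ ^ i * (c - 1)) := Real.sqrt_le_sqrt (hub i)
    rw [Real.sqrt_mul (by positivity), Real.sqrt_eq_rpow (θ ^ i), ← Real.rpow_natCast,
      ← Real.rpow_mul hθ0, mul_comm, mul_comm (i : ℝ), Real.rpow_mul hθ0, Real.rpow_natCast,
      ← Real.sqrt_eq_rpow] at this
    linarith
  have hcau : CauchySeq fun i => (u i).1 :=
    cauchySeq_of_le_geometric (√θ) (√(c - 1) / 2)
      (by rw [Real.sqrt_lt' one_pos]; simpa using hθ1) hud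
  obtain ⟨x, hx⟩ := cauchySeq_tendsto_of_complete hcau
  refine ⟨x, le_antisymm ?_ (bend_nonneg g x)⟩
  have h1 := ((continuous_bend g).tendsto x).comp hx
  have h2 : Filter.Tendsto (fun i => θ ^ i * (c - 1)) Filter.atTop (𝓝 (0 * (c - 1))) :=
    (tendsto_pow_atTop_nhds_zero_of_lt_one hθ0 hθ1).mul_const _
  rw [zero_mul] at h2
  exact le_of_tendsto_of_tendsto' h1 h2 hub

theorem dist_iterate_of_bend_eq_zero {g : HypSpace n ≃ᵢ HypSpace n} {x : HypSpace n}
    (hx : bend g x = 0) (i : ℕ) : dist x (g^[i] x) = i * dist x (g x) := by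
  have hv : ∀ z, bend g z = 0 → z.vec + (g (g z)).vec = (2 * form z (g z)) • (g z).vec := by
    intro z hz
    have := eq_zero_of_orthogonal (lorentz_bendVec_left g z)
      (by rw [lorentz_bendVec_self, hz]; simp)
    exact sub_eq_zero.1 this
  have hb : ∀ i, bend g (g^[i] x) = 0 ∧ form (g^[i] x) (g (g^[i] x)) = form x (g x) := by
    intro i
    induction i with
    | zero => exact ⟨hx, rfl⟩
    | succ i ih =>
      rw [Function.iterate_succ_apply', bend_map (fun _ => rfl), form_map]
      exact ih
  have hf : ∀ i : ℕ, form x (g^[i] x) = Real.cosh (i * dist x (g x)) ∧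
      form x (g^[i + 1] x) = Real.cosh ((i + 1 : ℕ) * dist x (g x)) := by
    intro i
    induction i with
    | zero => simp [form_self, cosh_dist]
    | succ i ih =>
      refine ⟨ih.2, ?_⟩
      -- Collinearity gives the recursion u(i+2) = 2 cosh L · u(i+1) - u(i), solved by u(i) = cosh
      -- (i L).
      have h := congrArg (lorentz x.vec) (hv _ (hb i).1)
      simp only [map_add, map_smul, smul_eq_mul, lorentz_vec, (hb i).2] at h
      rw [← Function.iterate_succ_apply' g, ← Function.iterate_succ_apply' g, ih.1, ih.2,
        ← cosh_dist x (g x)] at h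
      rw [eq_sub_of_add_eq' h]
      push_cast
      rw [show ((i : ℝ) + 1 + 1) * dist x (g x)
        = ((i : ℝ) + 1) * dist x (g x) + dist x (g x) by ring,
        show (i : ℝ) * dist x (g x) = ((i : ℝ) + 1) * dist x (g x) - dist x (g x) by ring,
        Real.cosh_add, Real.cosh_sub]
      ring
  exact dist_eq_of_form_eq (by positivity) (hf i).1

/-- The orbit of `x` advances at the exact linear rate `dist x (g x)`, that of `z` at most at rate
`dist z (g z)`, and the two orbits stay at constant distance. -/
theorem dist_le_of_bend_eq_zero {g : HypSpace n ≃ᵢ HypSpace n} {x : HypSpace n}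
    (hx : bend g x = 0) (z : HypSpace n) : dist x (g x) ≤ dist z (g z) := by
  have h1 : ∀ i : ℕ, dist (g^[i] z) (g^[i] x) = dist z x := by
    intro i
    induction i with
    | zero => rfl
    | succ i ih => rw [Function.iterate_succ_apply', Function.iterate_succ_apply', g.dist_eq, ih]
  have h2 : ∀ i : ℕ, dist z (g^[i] z) ≤ i * dist z (g z) := by
    intro i
    induction i with
    | zero => simp
    | succ i ih =>
      have := dist_triangle z (g z) (g (g^[i] z))
      rw [g.dist_eq] at this
      rw [Function.iterate_succ_apply']
      push_cast
      linarith
  by_contra! hlt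
  obtain ⟨i, hi⟩ := exists_nat_gt (2 * dist x z / (dist x (g x) - dist z (g z)))
  rw [div_lt_iff₀ (by linarith)] at hi
  have h3 := dist_iterate_of_bend_eq_zero hx i
  have h4 := dist_triangle4 x z (g^[i] z) (g^[i] x)
  have h5 := h2 i
  rw [h1, dist_comm z x] at h4
  nlinarith

/-- An isometry with displacement bounded below has a point that lies in all its invariant
closed convex sets. -/
theorem exists_mem_of_displacement {g : HypSpace n ≃ᵢ HypSpace n} {ε : ℝ} (hε : 0 < ε)
    (hg : ∀ z, ε ≤ dist z (g z)) :
    ∃ x, ∀ C : Set (HypSpace n), C.Nonempty → IsClosed C → GeodesicallyConvex C →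
      (∀ z ∈ C, g z ∈ C) → (∀ z ∈ C, g.symm z ∈ C) → x ∈ C := by
  obtain ⟨x, hx⟩ := exists_bend_eq_zero (g := g) (Real.one_lt_cosh.2 hε.ne') (fun z => by
    rw [← cosh_dist, Real.cosh_le_cosh, abs_of_pos hε, abs_of_nonneg dist_nonneg]
    exact hg z)
  refine ⟨x, fun C hne hcl hC hgC hgC' => ?_⟩
  obtain ⟨a, ha⟩ := exists_isNearest hcl hne x
  have h1 := ha.form_map_sub_one_le hC hgC hgC'
  have h2 := form_le_form_iff.2 (dist_le_of_bend_eq_zero hx a)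
  have h3 : 1 < form a (g a) := by
    rw [← cosh_dist, Real.one_lt_cosh]
    exact (hε.trans_le (hg a)).ne'
  have h4 := one_le_form x a
  -- The displacement at a is minimal on x, but smaller than at x by the factor `form x a ^ 2`
  -- unless x = a.
  have h5 : form x a = 1 := by
    refine le_antisymm ?_ h4
    by_contra! hlt
    have h6 : 1 < form x a ^ 2 := by nlinarith
    nlinarith [mul_pos (sub_pos.2 h6) (sub_pos.2 h3)]
  rw [eq_of_form_eq_one x a h5]
  exact ha.1

end HypSpace

/-! ### Hulls of quasiconvex sets -/

section Quasiconvex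

open HypSpace

variable {n : ℕ}

theorem isQuasiconvex_iff {D : ℝ} {A : Set (HypSpace n)} :
    IsQuasiconvex D A ↔ ∀ x ∈ A, ∀ y ∈ A, ∀ z, Btw x z y → z ∈ Metric.cthickening D A := by
  constructor
  · intro h x hx y hy z hz
    obtain ⟨S, hS⟩ := exists_isGeodesicSegment x y
    refine h x hx y hy S hS ?_
    rw [hS.eq_setOf_btw]
    exact hz
  · intro h x hx y hy S hS z hz
    rw [hS.eq_setOf_btw] at hz
    exact h x hx y hy z hz

theorem lt_dist_of_notMem_cthickening {D : ℝ} {A : Set (HypSpace n)} {p a : HypSpace n}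
    (hp : p ∉ Metric.cthickening D A) (ha : a ∈ A) : D < dist p a := by
  by_contra! h
  exact hp (Metric.mem_cthickening_of_dist_le p a D A ha h)

/-- The inequality is linear in `z`, hence inherited by nonnegative combinations. -/
theorem geodesicallyConvex_halfSpace (p q : HypSpace n) :
    GeodesicallyConvex {z | form z q ≤ form z p} := by
  rw [geodesicallyConvex_iff]
  intro x hx y hy z hz
  obtain ⟨s, t, hs, ht, h⟩ := hz.exists_combination
  simp only [mem_ofPred_eq] at hx hy ⊢
  rw [form_combination h, form_combination h]
  gcongr

theorem subset_geodesicHull {M : Type*} [MetricSpace M] (A : Set M) : A ⊆ geodesicHull A :=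
  subset_sInter fun _ hC => hC.2

/-- The hull of a quasiconvex set lies in a neighborhood of the set. -/
theorem geodesicHull_subset_cthickening {D : ℝ} (hD : 0 ≤ D) {A : Set (HypSpace n)}
    (hA : IsQuasiconvex D A) (hne : A.Nonempty) :
    geodesicHull A ⊆ Metric.cthickening (D + 5 * thinConst) A := by
  rw [isQuasiconvex_iff] at hA
  intro p hp
  by_contra hfar
  have hδ := thinConst_pos
  have hA' : ∀ a ∈ A, D + 5 * thinConst < dist p a := fun a ha =>
    lt_dist_of_notMem_cthickening hfar ha
  have hseg : ∀ a ∈ A, ∀ b ∈ A, ∀ z, Btw a z b → 5 * thinConst ≤ dist p z := by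
    intro a ha b hb z hz
    have h1 : Metric.infDist z A ≤ D :=
      ENNReal.toReal_le_of_le_ofReal hD (Metric.mem_cthickening_iff.1 (hA a ha b hb z hz))
    have h2 : D + 5 * thinConst ≤ Metric.infDist p A :=
      (Metric.le_infDist hne).2 fun {a} ha => (hA' a ha).le
    have h3 := Metric.infDist_le_infDist_add_dist (s := A) (x := p) (y := z)
    linarith
  obtain ⟨a₀, ha₀⟩ := hne
  -- Separation by the bisector of p and q. With q at depth 3δ, being δ-close to [p, a] makes q
  -- closer to a than p is, while being δ-close to [a, a₀] would put p within 4δ of that segment.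
  obtain ⟨q, hq, hpq⟩ := exists_btw_dist_eq p a₀ (t := 3 * thinConst) (by positivity)
    (by linarith [hA' a₀ ha₀])
  have hK : A ⊆ {z | form z q ≤ form z p} := by
    intro a ha
    rw [mem_ofPred_eq, form_le_form_iff]
    obtain ⟨q', h | h, hd⟩ := hq.thin a
    · have h1 := dist_triangle a q' q
      have h2 := dist_triangle p q' q
      unfold HypSpace.Btw at h
      rw [dist_comm q' q] at h1 h2
      rw [dist_comm q' a, dist_comm p a] at h
      linarith
    · have h1 := hseg a ha a₀ ha₀ q' h
      have h2 := dist_triangle p q q'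
      linarith
  have h := hp _ ⟨geodesicallyConvex_halfSpace p q, hK⟩
  rw [mem_ofPred_eq, form_le_form_iff, dist_self, hpq] at h
  linarith

/-! ### The thickened hull -/

variable {ε : ℝ} {Γ : Subgroup (HypSpace n ≃ᵢ HypSpace n)}

theorem isClosed_thickenedHull : IsClosed (thickenedHull ε Γ) :=
  isClosed_sInter fun _ hC => hC.2.1

theorem geodesicallyConvex_thickenedHull : GeodesicallyConvex (thickenedHull ε Γ) :=
  fun x hx y hy S hS => subset_sInter fun C hC =>
    hC.2.2.1 x (hx C hC) y (hy C hC) S hS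

theorem map_mem_thickenedHull {γ : HypSpace n ≃ᵢ HypSpace n} (hγ : γ ∈ Γ) {x : HypSpace n}
    (hx : x ∈ thickenedHull ε Γ) : γ x ∈ thickenedHull ε Γ :=
  fun C hC => hC.2.2.2.1 γ hγ x (hx C hC)

theorem le_dist_of_notMem_thickenedHull {γ : HypSpace n ≃ᵢ HypSpace n} (hγ : γ ∈ Γ)
    (h1 : γ ≠ 1) {x : HypSpace n} (hx : x ∉ thickenedHull ε Γ) : ε ≤ dist x (γ x) := by
  by_contra! h
  exact hx fun C hC => hC.2.2.2.2 ⟨γ, hγ, h1, h⟩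

/-- Either `γ` moves some point by less than ε, and that point is thin, or its displacement is
bounded below and an axis point lies in every admissible set. -/
theorem thickenedHull_nonempty (hε : 0 < ε) {γ : HypSpace n ≃ᵢ HypSpace n} (hγ : γ ∈ Γ)
    (h1 : γ ≠ 1) : (thickenedHull ε Γ).Nonempty := by
  by_cases h : ∀ z, ε ≤ dist z (γ z)
  · obtain ⟨x, hx⟩ := exists_mem_of_displacement hε h
    refine ⟨x, fun C hC => hx C hC.1 hC.2.1 hC.2.2.1 (hC.2.2.2.1 γ hγ) ?_⟩
    exact hC.2.2.2.1 γ⁻¹ (Γ.inv_mem hγ)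
  · push Not at h
    obtain ⟨z, hz⟩ := h
    exact ⟨z, fun C hC => hC.2.2.2.2 ⟨γ, hγ, h1, hz⟩⟩

/-- For the trivial group every singleton is one of the intersected sets. -/
theorem thickenedHull_bot_subset (x : HypSpace n) :
    thickenedHull ε (⊥ : Subgroup (HypSpace n ≃ᵢ HypSpace n)) ⊆ {x} := by
  refine sInter_subset_of_mem ⟨singleton_nonempty x, isClosed_singleton, ?_, ?_, ?_⟩
  · rw [geodesicallyConvex_iff]
    rintro _ rfl _ rfl z hz
    exact btw_self_iff.1 hz
  · rintro γ hγ _ rfl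
    rw [Subgroup.mem_bot.1 hγ]
    rfl
  · rintro z ⟨γ, hγ, h1, -⟩
    exact absurd (Subgroup.mem_bot.1 hγ) h1

/-! ### Segments that pass near a point -/

/-- The segment from `a` to its base point `o a` passes within distance `r` of `p`. -/
def PassesNear (p : HypSpace n) (o : HypSpace n → HypSpace n) (a : HypSpace n) (r : ℝ) : Prop :=
  ∃ q, Btw a q (o a) ∧ dist p q ≤ r

theorem PassesNear.mono {p : HypSpace n} {o : HypSpace n → HypSpace n} {a : HypSpace n}
    {r s : ℝ} (h : PassesNear p o a r) (hrs : r ≤ s) : PassesNear p o a s :=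
  let ⟨q, hq, hd⟩ := h
  ⟨q, hq, hd.trans hrs⟩

/-- In the quadrilateral a, b, o b, o a the sides [a, b] and [o b, o a] lie in `A`, too far from
`p`, so only the side [b, o b] can pass near the point `q`. -/
theorem PassesNear.step {A : Set (HypSpace n)} {p : HypSpace n} {o : HypSpace n → HypSpace n}
    {a b : HypSpace n} {r R : ℝ} (hp : ∀ z ∈ A, R < dist p z)
    (ho : ∀ z, Btw (o b) z (o a) → z ∈ A) (hab : ∀ z, Btw a z b → z ∈ A)
    (hR : r + 2 * thinConst ≤ R) (h : PassesNear p o a r) :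
    PassesNear p o b (r + 2 * thinConst) := by
  obtain ⟨q, hq, hd⟩ := h
  obtain ⟨q', h', hd'⟩ := hq.thin_quadrilateral b (o b)
  have hpq := dist_triangle p q q'
  rcases h' with h' | h' | h'
  · linarith [hp q' (hab q' h')]
  · exact ⟨q', h', by linarith⟩
  · linarith [hp q' (ho q' h')]

/-- How far from an invariant convex set translates of perpendiculars diverge. -/
noncomputable def divergenceDepth (ε R : ℝ) : ℝ := Real.cosh (4 * R) / (Real.cosh ε - 1)

theorem divergenceDepth_pos (hε : 0 < ε) (R : ℝ) : 0 < divergenceDepth ε R :=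
  div_pos (Real.cosh_pos _) (sub_pos.2 (Real.one_lt_cosh.2 hε.ne'))

/-- If both perpendiculars pass near `p`, at q and q', the heights of q and q' over `C` differ by at
most 2R. Hence q' is 2R-close to g q, and g moves q by at most 4R, too little at the depth of q. -/
theorem not_passesNear_map (hε : 0 < ε) {C : Set (HypSpace n)}
    (hC : GeodesicallyConvex C) {g : HypSpace n ≃ᵢ HypSpace n} (hg : ∀ z ∈ C, g z ∈ C)
    (hg' : ∀ z ∈ C, g.symm z ∈ C) (hout : ∀ z, z ∉ C → ε ≤ dist z (g z))
    {o : HypSpace n → HypSpace n} (ho : ∀ a, IsNearest C a (o a)) {p a : HypSpace n} {R : ℝ}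
    (hp : ∀ z ∈ C, R + divergenceDepth ε R < dist p z) (h : PassesNear p o a R) :
    ¬ PassesNear p o (g a) R := by
  rintro ⟨q', hq', hd'⟩
  obtain ⟨q, hq, hd⟩ := h
  have hh := divergenceDepth_pos hε R
  rw [((ho (g a)).unique hC ((ho a).map hg hg'))] at hq'
  set b := o a
  have hqb : IsNearest C q b := (ho a).of_btw hq
  have hqb' : IsNearest C q' (g b) := ((ho a).map hg hg').of_btw hq'
  have hqq : dist q q' ≤ 2 * R := by
    linarith [dist_triangle q p q', dist_comm q p]
  have h1 := hqb.2 _ (hg b hqb.1)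
  have h2 := hqb'.2 _ hqb.1
  have h3 := dist_triangle q q' (g b)
  have h4 := dist_triangle q' q b
  rw [dist_comm q' q] at h4
  have h5 : dist q' (g q) ≤ 2 * R := by
    rw [hq'.symm.dist_eq_abs (hq.map g).symm, g.dist_eq, abs_le, dist_comm (g b), dist_comm b]
    constructor <;> linarith
  have h6 : dist q (g q) ≤ 4 * R := by linarith [dist_triangle q q' (g q)]
  have hdepth : divergenceDepth ε R < dist q b := by
    linarith [hp b hqb.1, dist_triangle p q b]
  -- The foot b lies in C, where displacements may be small, but it is a limit of points of [b, q]
  -- outside C.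
  have hb : ε ≤ dist b (g b) := by
    refine le_of_forall_pos_le_add fun t ht => ?_
    obtain ⟨z, hz, hdz⟩ := exists_btw_dist_eq b q (t := min (t / 2) (dist b q))
      (by positivity) (min_le_right _ _)
    have hdz0 : 0 < dist b z := by
      rw [hdz, dist_comm]
      exact lt_min (half_pos ht) (hh.trans hdepth)
    have hzC : z ∉ C := fun hzC => by
      have := (hqb.of_btw hz.symm).2 z hzC
      rw [dist_self, dist_comm] at this
      linarith
    have h7 := hout z hzC
    have h8 := dist_triangle4 z b (g b) (g z)
    rw [g.dist_eq, dist_comm z b] at h8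
    have h9 : dist b z ≤ t / 2 := hdz ▸ min_le_left _ _
    linarith
  have hL := hqb.form_map_sub_one_le hC hg hg'
  have e1 : Real.cosh ε ≤ form b (g b) := by
    rw [← cosh_dist, Real.cosh_le_cosh, abs_of_pos hε, abs_of_nonneg dist_nonneg]
    exact hb
  have e2 : form q (g q) ≤ Real.cosh (4 * R) := by
    rw [← cosh_dist, Real.cosh_le_cosh, abs_of_nonneg dist_nonneg]
    exact h6.trans (le_abs_self _)
  have e3 : divergenceDepth ε R ≤ form q b := by
    rw [← cosh_dist]
    exact hdepth.le.trans ((Real.self_le_sinh_iff.2 dist_nonneg).trans (Real.sinh_lt_cosh _).le)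
  have e4 : 0 < Real.cosh ε - 1 := sub_pos.2 (Real.one_lt_cosh.2 hε.ne')
  have e5 : divergenceDepth ε R * (Real.cosh ε - 1) = Real.cosh (4 * R) :=
    div_mul_cancel₀ _ e4.ne'
  have e6 := one_le_form q b
  have e7 : divergenceDepth ε R ≤ form q b ^ 2 := by nlinarith
  have e8 : divergenceDepth ε R * (Real.cosh ε - 1) ≤ form q b ^ 2 * (form b (g b) - 1) := by
    gcongr
  linarith

end Quasiconvex

/-! ### Growing sets of vertices -/

namespace SerreGraph

variable {X : SerreGraph.{u}} {Δ : Subgroup X.Aut}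

theorem exists_of_quotientEdges_eq {e e' : X.E}
    (h : (Quot.mk _ e : X.QuotientEdges Δ) = Quot.mk _ e') :
    ∃ δ ∈ Δ, e' = δ.1.2 e ∨ e' = X.rev (δ.1.2 e) := by
  have hinv : ∀ (δ : X.Aut) (e : X.E), (δ⁻¹).1.2 (δ.1.2 e) = e := fun δ e =>
    Equiv.symm_apply_apply δ.1.2 e
  have hmul : ∀ (δ δ' : X.Aut) (e : X.E), (δ * δ').1.2 e = δ.1.2 (δ'.1.2 e) := fun _ _ _ => rfl
  have h' := Quot.eqvGen_exact h
  clear h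
  induction h' with
  | rel _ _ h => exact h
  | refl e => exact ⟨1, Δ.one_mem, Or.inl rfl⟩
  | symm e e' _ ih =>
    obtain ⟨δ, hδ, rfl | rfl⟩ := ih
    · exact ⟨δ⁻¹, Δ.inv_mem hδ, Or.inl (hinv δ e).symm⟩
    · refine ⟨δ⁻¹, Δ.inv_mem hδ, Or.inr ?_⟩
      rw [(δ⁻¹).2.2, X.rev_rev, hinv]
  | trans e e' e'' _ _ ih ih' =>
    obtain ⟨δ, hδ, h⟩ := ih
    obtain ⟨δ', hδ', h'⟩ := ih'
    refine ⟨δ' * δ, Δ.mul_mem hδ' hδ, ?_⟩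
    rw [hmul]
    rcases h with rfl | rfl <;> rcases h' with rfl | rfl
    · exact Or.inl rfl
    · exact Or.inr rfl
    · exact Or.inr (δ'.2.2 _).symm
    · left
      rw [δ'.2.2, X.rev_rev]

/-- An increasing sequence of sets of vertices, each of which contains the neighbors of the one
before, exhausts a connected graph in as many steps as the quotient has edges, if no step adds
translates of vertices that are already there. -/
theorem mem_of_growth (hX : X.Connected) (hfin : Finite (X.QuotientEdges Δ)) {k : ℕ}
    (hk : Nat.card (X.QuotientEdges Δ) = k) {U : ℕ → Set X.V} (h0 : (U 0).Nonempty)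
    (hmono : Monotone U) (hstep : ∀ j ≤ k, ∀ e, X.src e ∈ U j → X.tgt e ∈ U (j + 1))
    (htrans : ∀ j ≤ k, ∀ δ ∈ Δ, ∀ v, v ∈ U (j + 1) → δ.1.1 v ∈ U j → v ∈ U j) (v : X.V) :
    v ∈ U (k + 1) := by
  -- The classes of edges with both ends in U j. The k + 2 sets B 0 ⊆ ... ⊆ B (k + 1) cannot all be
  -- distinct among k classes.
  let B : ℕ → Set (X.QuotientEdges Δ) := fun j =>
    {q | ∃ e, Quot.mk _ e = q ∧ X.src e ∈ U j ∧ X.tgt e ∈ U j}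
  have hB : ∀ j, B j ⊆ B (j + 1) := by
    rintro j q ⟨e, he, h1, h2⟩
    exact ⟨e, he, hmono j.le_succ h1, hmono j.le_succ h2⟩
  obtain ⟨j, hj, hBj⟩ : ∃ j ≤ k, B (j + 1) ⊆ B j := by
    by_contra! hne
    have hcard : ∀ j ≤ k + 1, j ≤ (B j).ncard := by
      intro j
      induction j with
      | zero => simp
      | succ j ih =>
        intro hj
        have h1 := ih (by omega)
        have h2 := Set.ncard_lt_ncard ⟨hB j, hne j (by omega)⟩ (Set.toFinite _)
        omega
    have h1 := hcard (k + 1) le_rfl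
    have h2 := Set.ncard_le_card (B (k + 1))
    omega
  -- An edge leaving U j has its class in B (j + 1), hence in B j, so a translate of its far end is
  -- already in U j, and `htrans` applies.
  have hnbr : ∀ e, X.src e ∈ U j → X.tgt e ∈ U j := by
    intro e he
    have he' := hstep j hj e he
    obtain ⟨e', hq, h1, h2⟩ := hBj ⟨e, rfl, hmono j.le_succ he, he'⟩
    obtain ⟨δ, hδ, h | h⟩ := exists_of_quotientEdges_eq hq.symm
    · refine htrans j hj δ hδ _ he' ?_
      rwa [tgt, ← δ.2.1, ← δ.2.2, ← h]
    · refine htrans j hj δ hδ _ he' ?_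
      rwa [tgt, ← δ.2.1, ← δ.2.2, ← h]
  obtain ⟨v₀, hv₀⟩ := h0
  have hv : v ∈ U j := by
    have := hX.2 v₀ v
    induction this with
    | refl => exact hmono (Nat.zero_le j) hv₀
    | tail _ h ih =>
      obtain ⟨e, rfl, rfl⟩ := h
      exact hnbr e ih
  exact hmono (by omega) hv

/-- A vertex as a point of the realization. -/
def vertex (v : X.V) : X.Realization := Quot.mk X.Glue (Sum.inl v)

theorem vertex_src_mem_edgeSet (e : X.E) : vertex (X.src e) ∈ X.edgeSet e :=
  ⟨0, Quot.sound (Glue.start e)⟩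

theorem vertex_tgt_mem_edgeSet (e : X.E) : vertex (X.tgt e) ∈ X.edgeSet e := by
  refine ⟨1, (Quot.sound (Glue.flip e 1)).trans ?_⟩
  rw [unitInterval.symm_one]
  exact Quot.sound (Glue.start (X.rev e))

end SerreGraph

/-! ### Carrier graphs -/

section CarrierGraph

open HypSpace SerreGraph

variable {n : ℕ} {X : SerreGraph.{u}} {Δ : Subgroup X.Aut}
  {Γ : Subgroup (HypSpace n ≃ᵢ HypSpace n)} {f : C(X.Realization, HypSpace n)}

theorem mem_range_of_btw_edge
    (hf : ∀ e : X.E, ∃ x y : HypSpace n, IsGeodesicSegment x y (f '' X.edgeSet e)) {e : X.E}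
    {a b : HypSpace n} (ha : a ∈ f '' X.edgeSet e) (hb : b ∈ f '' X.edgeSet e) {z : HypSpace n}
    (hz : Btw a z b) : z ∈ range f := by
  obtain ⟨x, y, h⟩ := hf e
  exact image_subset_range _ _
    (geodesicallyConvex_iff.1 (geodesicallyConvex_segment h) a ha b hb z hz)

theorem exists_vertex_btw
    (hf : ∀ e : X.E, ∃ x y : HypSpace n, IsGeodesicSegment x y (f '' X.edgeSet e))
    {x : HypSpace n} (hx : x ∈ range f) :
    ∃ v : X.V, ∀ z, Btw x z (f (vertex v)) → z ∈ range f := by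
  obtain ⟨p, rfl⟩ := hx
  obtain ⟨v | ⟨e, t⟩, rfl⟩ := Quot.exists_rep p
  · refine ⟨v, fun z hz => ?_⟩
    rw [btw_self_iff.1 hz]
    exact mem_range_self _
  · exact ⟨X.src e, fun z => mem_range_of_btw_edge hf ⟨_, ⟨t, rfl⟩, rfl⟩
      ⟨_, vertex_src_mem_edgeSet e, rfl⟩⟩

/-- If a segment from a point of the carrier graph to its base point passes through a point far
from the carrier graph, then so do nearly the segments from all vertices to their base points. -/
theorem passesNear_vertex (hX : IsEquivariantCarrierGraph X Δ Γ f)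
    (hf : ∀ e : X.E, ∃ x y : HypSpace n, IsGeodesicSegment x y (f '' X.edgeSet e)) {k : ℕ}
    (hk : Nat.card (X.QuotientEdges Δ) = k) {A : Set (HypSpace n)} (hA : range f ⊆ A)
    {p : HypSpace n} {o : HypSpace n → HypSpace n} {R : ℝ}
    (hR : R = 2 * thinConst * (k + 2)) (hp : ∀ z ∈ A, R < dist p z)
    (ho : ∀ a b z, Btw (o a) z (o b) → z ∈ A)
    (htrans : ∀ γ ∈ Γ, ∀ a, PassesNear p o a R → PassesNear p o (γ a) R → γ = 1)
    {x : HypSpace n} (hx : x ∈ range f) (hpx : Btw x p (o x)) (v : X.V) :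
    PassesNear p o (f (vertex v)) R := by
  have hδ := thinConst_pos
  obtain ⟨ρ, -, hρ⟩ := hX.equivariant
  have hle : ∀ j : ℕ, j ≤ k → 2 * thinConst * (j + 1) + 2 * thinConst ≤ R := by
    intro j hj
    have : (j : ℝ) ≤ k := Nat.cast_le.2 hj
    rw [hR]
    nlinarith
  -- The summand 1 in j + 1 pays for the passage from x to a first vertex; each edge step then costs
  -- another 2 `thinConst`, and k + 1 of them end exactly at R.
  have key : v ∈ {v : X.V | PassesNear p o (f (vertex v)) (2 * thinConst * ((k + 1 : ℕ) + 1))} := by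
    refine mem_of_growth (U := fun j : ℕ =>
      {v : X.V | PassesNear p o (f (vertex v)) (2 * thinConst * (j + 1))})
      hX.connected hX.finite_edges hk ?_ ?_ ?_ ?_ v
    · obtain ⟨v₀, hv₀⟩ := exists_vertex_btw hf hx
      have h0 : PassesNear p o x 0 := ⟨p, hpx, (dist_self p).le⟩
      have h1 := h0.step (b := f (vertex v₀)) hp (ho _ _) (fun z hz => hA (hv₀ z hz))
        (by nlinarith [hle 0 k.zero_le])
      exact ⟨v₀, h1.mono (by simp)⟩
    · intro i j hij w hw
      have : (i : ℝ) ≤ j := Nat.cast_le.2 hij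
      exact PassesNear.mono hw (by gcongr)
    · intro j hj e he
      refine (PassesNear.step hp (ho _ _) (fun z hz => hA ?_) (hle j hj) he).mono ?_
      · exact mem_range_of_btw_edge hf ⟨_, vertex_src_mem_edgeSet e, rfl⟩
          ⟨_, vertex_tgt_mem_edgeSet e, rfl⟩ hz
      · push_cast
        linarith
    · intro j hj δ hδΔ w hw hδw
      have hf' : f (vertex (δ.1.1 w)) = (ρ ⟨δ, hδΔ⟩).1 (f (vertex w)) := hρ ⟨δ, hδΔ⟩ (vertex w)
      have h1 : PassesNear p o (f (vertex w)) R := by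
        refine PassesNear.mono hw ?_
        push_cast
        linarith [hle j hj]
      have h2 : PassesNear p o (f (vertex (δ.1.1 w))) R := by
        refine PassesNear.mono hδw ?_
        linarith [hle j hj]
      rw [hf'] at h2
      -- The two perpendiculars force ρ δ = 1, so δ w and w have the same image and the smaller
      -- radius carries over.
      have h3 := htrans _ (ρ ⟨δ, hδΔ⟩).2 _ h1 h2
      rw [h3] at hf'
      rw [mem_ofPred_eq, hf'] at hδw
      exact hδw
  refine PassesNear.mono key (le_of_eq ?_)
  rw [hR]
  push_cast
  ring

/-- The union of the thickened hull and a carrier graph is uniformly quasiconvex. -/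
theorem isQuasiconvex_thickenedHull_union_range {ε : ℝ} (hε : 0 < ε)
    (hX : IsEquivariantCarrierGraph X Δ Γ f)
    (hf : ∀ e : X.E, ∃ x y : HypSpace n, IsGeodesicSegment x y (f '' X.edgeSet e)) {k : ℕ}
    (hk : Nat.card (X.QuotientEdges Δ) = k) {R : ℝ} (hR : R = 2 * thinConst * (k + 2)) :
    IsQuasiconvex (R + divergenceDepth ε R + 2 * thinConst) (thickenedHull ε Γ ∪ range f) := by
  have hδ := thinConst_pos
  have hh := divergenceDepth_pos hε R
  rw [isQuasiconvex_iff]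
  intro x hx y hy z hz
  by_contra hfar
  have hfar' := fun a (ha : a ∈ thickenedHull ε Γ ∪ range f) =>
    lt_dist_of_notMem_cthickening hfar ha
  obtain ⟨v₀⟩ := hX.connected.1
  rcases Γ.bot_or_exists_ne_one with hΓ | ⟨γ, hγ, hγ1⟩
  · have hxf : thickenedHull ε Γ ∪ range f ⊆ range f := by
      refine union_subset ?_ subset_rfl
      rw [hΓ]
      refine (thickenedHull_bot_subset (f (vertex v₀))).trans ?_
      exact singleton_subset_iff.2 (mem_range_self _)
    obtain ⟨v, hv⟩ := exists_vertex_btw hf (hxf hx)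
    -- With base point x for every vertex, the segment from v to x would pass near z, but v was
    -- chosen so that this segment lies in the image of the graph.
    obtain ⟨q, hq, hd⟩ := passesNear_vertex (o := fun _ => x) (p := z) hX hf hk
      subset_union_right hR (fun a ha => by linarith [hfar' a ha])
      (fun _ _ a ha => btw_self_iff.1 ha ▸ hx)
      (fun γ hγ _ _ _ => by rwa [hΓ, Subgroup.mem_bot] at hγ) (hxf hy) hz.symm v
    linarith [hfar' q (Or.inr (hv q hq.symm))]
  · have hne := thickenedHull_nonempty hε hγ hγ1
    have hconv := geodesicallyConvex_thickenedHull (ε := ε) (Γ := Γ)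
    choose o ho using exists_isNearest (isClosed_thickenedHull (ε := ε) (Γ := Γ)) hne
    have hdisp : ∀ g ∈ Γ, g ≠ 1 → ∀ p a, (∀ z ∈ thickenedHull ε Γ,
        R + divergenceDepth ε R < dist p z) → PassesNear p o a R → ¬ PassesNear p o (g a) R :=
      fun g hg hg1 p a hp h => not_passesNear_map hε hconv
        (fun _ => map_mem_thickenedHull hg) (fun _ => map_mem_thickenedHull (Γ.inv_mem hg))
        (fun _ => le_dist_of_notMem_thickenedHull hg hg1) ho hp h
    have hleg : ∀ w ∈ thickenedHull ε Γ ∪ range f, ∀ p, Btw w p (o w) →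
        ∃ a ∈ thickenedHull ε Γ ∪ range f, dist p a ≤ R + divergenceDepth ε R := by
      intro w hw p hp
      by_contra! hpfar
      rcases hw with hw | hw
      · have : w = o w := dist_le_zero.1 (((ho w).2 w hw).trans (dist_self w).le)
        rw [← this] at hp
        have h1 := hpfar w (Or.inl hw)
        rw [btw_self_iff.1 hp, dist_self] at h1
        have : 0 ≤ R := by rw [hR]; positivity
        linarith
      · have hall := passesNear_vertex (o := o) (p := p) hX hf hk
          subset_union_right hR (fun a ha => by linarith [hpfar a ha])
          (fun a b c hc => Or.inl
            (geodesicallyConvex_iff.1 hconv _ (ho a).1 _ (ho b).1 c hc))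
          (fun g hg a h1 h2 => by
            by_contra hg1
            exact hdisp g hg hg1 p a (fun c hc => hpfar c (Or.inl hc)) h1 h2) hw hp
        -- By surjectivity of ρ, γ maps the image of v₀ to the image of another vertex, whose
        -- perpendicular passes near p as well.
        obtain ⟨ρ, hρs, hρ⟩ := hX.equivariant
        obtain ⟨δ, hδ'⟩ := hρs ⟨γ, hγ⟩
        have e : f (vertex (δ.1.1.1 v₀)) = γ (f (vertex v₀)) := by
          have := hρ δ (vertex v₀)
          rw [hδ'] at this
          exact this
        refine hdisp γ hγ hγ1 p _ (fun c hc => hpfar c (Or.inl hc)) (hall v₀) ?_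
        rw [← e]
        exact hall _
    obtain ⟨z', h, hd⟩ := hz.thin_quadrilateral (o x) (o y)
    obtain ⟨a, ha, hda⟩ : ∃ a ∈ thickenedHull ε Γ ∪ range f,
        dist z' a ≤ R + divergenceDepth ε R := by
      rcases h with h | h | h
      · exact hleg x hx z' h
      · refine ⟨z', Or.inl (geodesicallyConvex_iff.1 hconv _ (ho x).1 _ (ho y).1 z' h), ?_⟩
        have : 0 ≤ R := by rw [hR]; positivity
        rw [dist_self]
        linarith
      · exact hleg y hy z' h.symm
    linarith [hfar' a ha, dist_triangle z z' a]

end CarrierGraph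

theorem mainTheorem8 (n : ℕ) (ε : ℝ) (hε : 0 < ε) (k : ℕ) :
    ∃ D : ℝ, 0 ≤ D ∧
      ∀ (X : SerreGraph.{u}) (Δ : Subgroup X.Aut)
        (Γ : Subgroup (HypSpace n ≃ᵢ HypSpace n)) (f : C(X.Realization, HypSpace n)),
        DiscreteTopology Γ →
        IsEquivariantCarrierGraph X Δ Γ f →
        (∀ e : X.E, ∃ x y : HypSpace n, IsGeodesicSegment x y (f '' X.edgeSet e)) →
        Nat.card (X.QuotientEdges Δ) = k →
        IsQuasiconvex D (thickenedHull ε Γ ∪ range f) ∧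
        thickenedHull ε Γ ∪ range f ⊆ thickenedHullOf ε (range f) Γ ∧
        thickenedHullOf ε (range f) Γ ⊆
          Metric.cthickening D (thickenedHull ε Γ ∪ range f) := by
  set R : ℝ := 2 * HypSpace.thinConst * (k + 2) with hR
  set D : ℝ := R + divergenceDepth ε R + 2 * HypSpace.thinConst with hD
  have hδ := HypSpace.thinConst_pos
  have hh := divergenceDepth_pos hε R
  have hD0 : 0 ≤ D := by positivity
  refine ⟨D + 5 * HypSpace.thinConst, by positivity, fun X Δ Γ f _ hX hf hk => ?_⟩
  have hq := isQuasiconvex_thickenedHull_union_range hε hX hf hk hR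
  rw [thickenedHullOf, union_comm (range f)]
  obtain ⟨v₀⟩ := hX.connected.1
  refine ⟨fun x hx y hy S hS => (hq x hx y hy S hS).trans
      (Metric.cthickening_mono (by linarith) _), subset_geodesicHull _,
    geodesicHull_subset_cthickening hD0 hq ⟨f (SerreGraph.vertex v₀), Or.inr (mem_range_self _)⟩⟩
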